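/- For $\lambda\in\mathbb{C}$ let $$C_n^\lambda(x)=\sum_{\ell=0}^{\lfloor n/2\rfloor}\frac{(-1)^\ell(\lambda)_{n-\ell}}{\ell!\,(n-2\ell)!}\,(2x)^{n-2\ell}\qquad(n=0,1,2,\ldots)$$ be the Gegenbauer polynomials, where $(a)_k=a(a+1)\cdots(a+k-1)$, and let ${}_2F_1(a,b;c;z)=\sum_{k\ge0}\frac{(a)_k(b)_k}{(c)_k\,k!}z^k$ $(|z|<1)$. Let $\lambda\in\mathbb{C}$ with $2\lambda\notin\{0,-1,-2,\ldots\}$, let $r\in(-1,1)$ and $x,y\in[-1,1]$. Then $1-2rxy+r^2>0$ and $$0\le Z:=\frac{4r^2(1-x^2)(1-y^2)}{(1-2rxy+r^2)^2}<1,$$ and, with both series absolutely convergent and with powers of positive numbers defined through the real logarithm, $$\sum_{n=0}^\infty\frac{n!}{(2\lambda)_n}\,r^n\,C_n^\lambda(x)\,C_n^\lambda(y)=\frac{1}{(1-2rxy+r^2)^{\lambda}}\;{}_2F_1\!\left(\tfrac12\lambda,\tfrac12(\lambda+1);\lambda+\tfrac12;Z\right)$$ and $$\sum_{n=0}^\infty\frac{\lambda+n}{\lambda}\,\frac{n!}{(2\lambda)_n}\,r^n\,C_n^\lambda(x)\,C_n^\lambda(y)=\frac{1-r^2}{(1-2rxy+r^2)^{\lambda+1}}\;{}_2F_1\!\left(\tfrac12(\lambda+1),\tfrac12(\lambda+2);\lambda+\tfrac12;Z\right).$$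 -/

import Mathlib

/-- The Gegenbauer (ultraspherical) polynomial `C_n^lam(x)`, given by its explicit expression
`∑_{l = 0}^{⌊n/2⌋} (-1)^l (lam)_{n-l} / (l! (n-2l)!) * (2x)^{n-2l}`,
where `(a)_k = a (a+1) ⋯ (a+k-1)` is the Pochhammer symbol. -/
noncomputable def gegenbauerC (n : ℕ) (lam x : ℂ) : ℂ :=
  ∑ l ∈ Finset.range (n / 2 + 1),
    (-1) ^ l * (ascPochhammer ℂ (n - l)).eval lam /
      ((Nat.factorial l : ℂ) * (Nat.factorial (n - 2 * l) : ℂ)) * (2 * x) ^ (n - 2 * l)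

/-!
Both identities are power series expansions in `r`, and the heart of the matter is the coefficient
of `r^n` in the first one, the product formula `gegenbauerC_mul_gegenbauerC`:
`n! / (2λ)_n C_n^λ(x) C_n^λ(y) = ∑_k (λ)_{2k} / ((λ + 1/2)_k k!) ((1 - x²)(1 - y²))^k
C_{n-2k}^{λ+2k}(xy)`.
Each side is annihilated by the difference of the Gegenbauer operators
`(1 - v²) ∂_v² - (2λ + 1) v ∂_v` in `v = x` and `v = y`. For the left side this is the differential
equation `gegenbauerPoly_ode`; for the right side the contributions of consecutive terms cancel
(`gegenbauerOp_sum_productTerm`). The two sides agree at `y = 1`, and a polynomial annihilated by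
that difference and divisible by `y - 1` is divisible by every power of `y - 1`
(`dvd_of_gegenbauerOp_eq`), hence zero. Here the hypothesis on `2λ` keeps the indicial factor
`2m + 2λ + 1` from vanishing.

Write `D = 1 - 2rxy + r²`. Since `4^k (λ/2)_k ((λ+1)/2)_k = (λ)_{2k}`, the right side of the first
identity is the sum over `k` of
`(λ)_{2k} / ((λ + 1/2)_k k!) ((1 - x²)(1 - y²) r²)^k D^(-λ-2k)`. For `|r| ≤ 1/16` every
`D^(-λ-2k)` may be expanded by the generating function `∑ C_m^μ(t) r^m = (1 - 2tr + r²)^(-μ)`, the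
resulting double series converges absolutely, and the product formula gives the first identity
(`hasSum_bilinearCoeff_of_small`). This argument does not reach all `|r| < 1`, because the double
series stops converging absolutely. Instead, `1 - 2tz + z²` avoids the branch cut for
`|z| < 1` and `t ∈ [-1, 1]`, so the generating function is holomorphic in the disc and its
coefficients grow subexponentially; thus the bilinear series is analytic on `(-1, 1)`. So is the
right side, as the argument of the hypergeometric function stays in `[0, 1)`, and the identity
theorem applies (`tsum_bilinearCoeff_eq_gegenbauerKernel`).

The second identity is the image of the first under `1 + λ⁻¹ r d/dr`. On the right this uses
`D - r dD/dr = 1 - r²` and the contiguity relation `mul_ordinaryHypergeometric_add_deriv`.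
-/

/-! ### Gegenbauer polynomials and their differential equation -/

open Polynomial in
/-- The Gegenbauer polynomial `C_n^μ` as an element of `ℂ[X]`. -/
noncomputable def gegenbauerPoly (n : ℕ) (μ : ℂ) : ℂ[X] :=
  ∑ l ∈ Finset.range (n / 2 + 1),
    C ((-1) ^ l * (ascPochhammer ℂ (n - l)).eval μ * 2 ^ (n - 2 * l) /
      ((Nat.factorial l : ℂ) * (Nat.factorial (n - 2 * l) : ℂ))) * X ^ (n - 2 * l)

theorem eval_gegenbauerPoly (n : ℕ) (μ x : ℂ) :
    (gegenbauerPoly n μ).eval x = gegenbauerC n μ x := by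
  simp only [gegenbauerPoly, gegenbauerC, Polynomial.eval_finsetSum, Polynomial.eval_mul,
    Polynomial.eval_C, Polynomial.eval_pow, Polynomial.eval_X]
  refine Finset.sum_congr rfl fun l _ => ?_
  rw [mul_pow]
  ring

theorem ascPochhammer_eval_succ_left (μ : ℂ) (n : ℕ) :
    (ascPochhammer ℂ (n + 1)).eval μ = μ * (ascPochhammer ℂ n).eval (μ + 1) := by
  simp [ascPochhammer_succ_left, Polynomial.eval_comp]

open Polynomial in
theorem derivative_gegenbauerPoly_succ (n : ℕ) (μ : ℂ) :
    derivative (gegenbauerPoly (n + 1) μ) = C (2 * μ) * gegenbauerPoly n (μ + 1) := by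
  simp only [gegenbauerPoly, derivative_sum, derivative_C_mul_X_pow, Finset.mul_sum]
  symm
  refine Finset.sum_subset_zero_on_sdiff (fun l => ?_) (fun l hl => ?_) (fun l hl => ?_)
  · simp only [Finset.mem_range]; omega
  · simp only [Finset.mem_sdiff, Finset.mem_range] at hl
    have : n + 1 - 2 * l = 0 := by omega
    simp [this]
  · simp only [Finset.mem_range] at hl
    obtain ⟨m, rfl⟩ : ∃ m, n = 2 * l + m := ⟨n - 2 * l, by omega⟩
    have h1 : 2 * l + m + 1 - 2 * l = m + 1 := by omega
    have h2 : 2 * l + m - 2 * l = m := by omega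
    have h3 : 2 * l + m + 1 - l = (l + m) + 1 := by omega
    have h4 : 2 * l + m - l = l + m := by omega
    rw [h1, h2, h3, h4, ascPochhammer_eval_succ_left, ← mul_assoc, ← C_mul, Nat.add_sub_cancel,
      Nat.factorial_succ]
    congr 2
    have : (Nat.factorial l : ℂ) ≠ 0 := by exact_mod_cast Nat.factorial_ne_zero l
    have : (Nat.factorial m : ℂ) ≠ 0 := by exact_mod_cast Nat.factorial_ne_zero m
    have : (m : ℂ) + 1 ≠ 0 := by exact_mod_cast Nat.succ_ne_zero m
    push_cast
    field_simp
    ring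

open Polynomial in
/-- The Gegenbauer differential equation. The operator takes the `l`-th term of `C_n^μ` to the
difference of two monomials, and these cancel between consecutive terms. -/
theorem gegenbauerPoly_ode (n : ℕ) (μ : ℂ) :
    (1 - X ^ 2) * derivative (derivative (gegenbauerPoly n μ)) -
      C (2 * μ + 1) * X * derivative (gegenbauerPoly n μ) +
      C (n * (n + 2 * μ)) * gegenbauerPoly n μ = 0 := by
  set a : ℕ → ℂ := fun l => (-1) ^ l * (ascPochhammer ℂ (n - l)).eval μ * 2 ^ (n - 2 * l) /
      ((Nat.factorial l : ℂ) * (Nat.factorial (n - 2 * l) : ℂ)) with ha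
  set U : ℕ → ℂ[X] := fun l => derivative (derivative (C (a l) * X ^ (n - 2 * l))) with hU
  set T : ℕ → ℂ[X] := fun l => C (4 * l * (n - l + μ) * a l) * X ^ (n - 2 * l) with hT
  have hP : gegenbauerPoly n μ = ∑ l ∈ Finset.range (n / 2 + 1), C (a l) * X ^ (n - 2 * l) := rfl
  have key : ∀ l ∈ Finset.range (n / 2 + 1),
      (1 - X ^ 2) * derivative (derivative (C (a l) * X ^ (n - 2 * l))) -
      C (2 * μ + 1) * X * derivative (C (a l) * X ^ (n - 2 * l)) +
      C (n * (n + 2 * μ)) * (C (a l) * X ^ (n - 2 * l)) = U l + T l := by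
    intro l hl
    simp only [Finset.mem_range] at hl
    obtain ⟨m, hm⟩ : ∃ m, n = 2 * l + m := ⟨n - 2 * l, by omega⟩
    have h2 : n - 2 * l = m := by omega
    simp only [hU, hT, h2]
    have hn : (n : ℂ) = 2 * l + m := by exact_mod_cast hm
    rw [hn]
    have hC2 : C (2 : ℂ) = 2 := rfl
    have hC4 : C (4 : ℂ) = 4 := rfl
    rcases m with _ | _ | m
    · simp [-mul_eq_mul_right_iff, hC2, hC4]
      ring
    · simp [-mul_eq_mul_right_iff, hC2, hC4]
      ring
    · simp only [derivative_C_mul_X_pow, show m + 1 + 1 - 1 = m + 1 by omega,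
        show m + 1 - 1 = m by omega]
      push_cast
      simp only [map_mul, map_add, map_sub, map_one, map_natCast, map_ofNat]
      ring
  have step : ∀ l ∈ Finset.range (n / 2), U l + T (l + 1) = 0 := by
    intro l hl
    simp only [Finset.mem_range] at hl
    obtain ⟨m, hm⟩ : ∃ m, n = 2 * l + 2 + m := ⟨n - (2 * l + 2), by omega⟩
    have h2 : n - 2 * l = m + 2 := by omega
    have h2' : n - 2 * (l + 1) = m := by omega
    have h3 : n - l = (l + m + 1) + 1 := by omega
    have h3' : n - (l + 1) = l + m + 1 := by omega
    have hn : (n : ℂ) = 2 * l + 2 + m := by exact_mod_cast hm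
    simp only [hU, hT, derivative_C_mul_X_pow, h2, h2', show m + 2 - 1 = m + 1 by omega,
      show m + 1 - 1 = m by omega]
    rw [← add_mul, ← C_add]
    convert zero_mul _
    rw [← C_0]
    congr 1
    simp only [ha, h2, h2', h3, h3', ascPochhammer_succ_eval (n := l + m + 1),
      Nat.factorial_succ, hn]
    have : (Nat.factorial l : ℂ) ≠ 0 := by exact_mod_cast Nat.factorial_ne_zero l
    have : (Nat.factorial m : ℂ) ≠ 0 := by exact_mod_cast Nat.factorial_ne_zero m
    have : (m : ℂ) + 1 ≠ 0 := by exact_mod_cast Nat.succ_ne_zero m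
    have : (l : ℂ) + 1 ≠ 0 := by exact_mod_cast Nat.succ_ne_zero l
    have : (m : ℂ) + 1 + 1 ≠ 0 := by exact_mod_cast Nat.succ_ne_zero (m + 1)
    push_cast
    field_simp
    ring
  rw [hP, derivative_sum, derivative_sum, Finset.mul_sum, Finset.mul_sum, Finset.mul_sum,
    ← Finset.sum_sub_distrib, ← Finset.sum_add_distrib, Finset.sum_congr rfl key,
    Finset.sum_add_distrib, Finset.sum_range_succ, Finset.sum_range_succ' T]
  have hU0 : U (n / 2) = 0 := by
    have : n - 2 * (n / 2) = 0 ∨ n - 2 * (n / 2) = 1 := by omega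
    rcases this with h | h <;> simp [hU, h]
  have hT0 : T 0 = 0 := by simp [hT]
  rw [hU0, hT0, add_zero, add_zero, ← Finset.sum_add_distrib, Finset.sum_eq_zero step]

/-- Evaluating the differential equation at `1` expresses `C_{n+1}^μ(1)` through
`C_n^{μ+1}(1)`. -/
theorem gegenbauerPoly_eval_one (n : ℕ) (μ : ℂ) (hμ : ∀ k : ℕ, 2 * μ ≠ -(k : ℂ)) :
    (gegenbauerPoly n μ).eval 1 = (ascPochhammer ℂ n).eval (2 * μ) / Nat.factorial n := by
  induction n generalizing μ with
  | zero => simp [gegenbauerPoly]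
  | succ n ih =>
    have h := congrArg (Polynomial.eval 1) (gegenbauerPoly_ode (n + 1) μ)
    rw [derivative_gegenbauerPoly_succ] at h
    simp only [Polynomial.eval_add, Polynomial.eval_sub, Polynomial.eval_mul, Polynomial.eval_C,
      Polynomial.eval_X, Polynomial.eval_pow, Polynomial.eval_one, Polynomial.eval_zero] at h
    rw [ih (μ + 1) fun k hk => hμ (k + 2) (by push_cast; linear_combination hk)] at h
    have h1 : (n : ℂ) + 1 + 2 * μ ≠ 0 := fun h => hμ (n + 1) (by push_cast; linear_combination h)
    have h2 : (Nat.factorial n : ℂ) ≠ 0 := by exact_mod_cast Nat.factorial_ne_zero n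
    have h3 : (n : ℂ) + 1 ≠ 0 := by exact_mod_cast Nat.succ_ne_zero n
    have h4 : (ascPochhammer ℂ (n + 1)).eval (2 * μ) * (2 * μ + (n + 1)) =
        2 * μ * ((2 * μ + 1) * (ascPochhammer ℂ n).eval (2 * (μ + 1))) := by
      have := ascPochhammer_succ_eval (n + 1) (2 * μ)
      rw [ascPochhammer_eval_succ_left, ascPochhammer_eval_succ_left,
        show 2 * μ + 1 + 1 = 2 * (μ + 1) by ring] at this
      rw [this]
      push_cast
      ring
    rw [Nat.factorial_succ]
    push_cast at h ⊢
    rw [eq_div_iff (mul_ne_zero h3 h2)]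
    apply mul_right_cancel₀ h1
    have h5 : (Polynomial.eval 1 (gegenbauerPoly (n + 1) μ)) * ((n + 1) * (n + 1 + 2 * μ)) *
       (Nat.factorial n) = (2 * μ + 1) * (2 * μ) * (ascPochhammer ℂ n).eval (2 * (μ + 1)) := by
      field_simp at h
      linear_combination h
    linear_combination h5 - h4

/-! ### The Gegenbauer operator for a derivation -/

section GegenbauerOp

variable {A : Type*} [CommRing A] [Algebra ℂ A]

/-- The Gegenbauer operator `(1 - v²) d² - (2μ + 1) v d` attached to a derivation `d` of a
`ℂ`-algebra and an element `v` playing the role of the variable. -/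
def gegenbauerOp (d : Derivation ℂ A A) (v : A) (μ : ℂ) (f : A) : A :=
  (1 - v ^ 2) * d (d f) - algebraMap ℂ A (2 * μ + 1) * v * d f

theorem gegenbauerOp_sub (d : Derivation ℂ A A) (v : A) (μ : ℂ) (f g : A) :
    gegenbauerOp d v μ (f - g) = gegenbauerOp d v μ f - gegenbauerOp d v μ g := by
  simp only [gegenbauerOp, map_sub]
  ring

theorem gegenbauerOp_sum {ι : Type*} (s : Finset ι) (d : Derivation ℂ A A) (v : A) (μ : ℂ)
    (f : ι → A) :
    gegenbauerOp d v μ (∑ i ∈ s, f i) = ∑ i ∈ s, gegenbauerOp d v μ (f i) := by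
  simp only [gegenbauerOp, map_sum, Finset.mul_sum, Finset.sum_sub_distrib]

theorem gegenbauerOp_mul_of_map_eq_zero (d : Derivation ℂ A A) (v : A) (μ : ℂ) {a : A}
    (ha : d a = 0) (f : A) : gegenbauerOp d v μ (a * f) = a * gegenbauerOp d v μ f := by
  simp only [gegenbauerOp, Derivation.leibniz, ha, smul_eq_mul, mul_zero, add_zero]
  ring

/-- In the variable `v`, the Gegenbauer polynomials are eigenvectors of the Gegenbauer operator. -/
theorem gegenbauerOp_aeval_gegenbauerPoly (d : Derivation ℂ A A) {v : A} (hv : d v = 1) (μ : ℂ)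
    (n : ℕ) :
    gegenbauerOp d v μ (Polynomial.aeval v (gegenbauerPoly n μ)) =
      -(algebraMap ℂ A (n * (n + 2 * μ)) * Polynomial.aeval v (gegenbauerPoly n μ)) := by
  have h := congrArg (Polynomial.aeval v) (gegenbauerPoly_ode n μ)
  simp only [map_add, map_sub, map_mul, map_pow, map_one, Polynomial.aeval_X, Polynomial.aeval_C,
    map_zero] at h
  simp only [gegenbauerOp, Derivation.map_aeval, hv, smul_eq_mul, mul_one, map_add, map_mul,
    map_one]
  linear_combination h

/-- The action of the Gegenbauer operator in `x` on `(1 - x²)^k b g(xy)`, multiplied by `1 - x²`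
so that no negative exponent occurs. -/
theorem gegenbauerOp_pow_mul_aeval (d : Derivation ℂ A A) {x y b : A} (hx : d x = 1) (hy : d y = 0)
    (hb : d b = 0) (μ : ℂ) (k : ℕ) (g : Polynomial ℂ) :
    (1 - x ^ 2) * gegenbauerOp d x μ ((1 - x ^ 2) ^ k * b * Polynomial.aeval (x * y) g) =
      (1 - x ^ 2) ^ k * b * (
        (-(2 * k) * (1 - x ^ 2) + 4 * k * (k - 1) * x ^ 2 +
            2 * k * algebraMap ℂ A (2 * μ + 1) * x ^ 2) * Polynomial.aeval (x * y) g
          - (1 - x ^ 2) * (4 * k + algebraMap ℂ A (2 * μ + 1)) * (x * y) *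
            Polynomial.aeval (x * y) (Polynomial.derivative g)
          + (1 - x ^ 2) ^ 2 * y ^ 2 *
            Polynomial.aeval (x * y) (Polynomial.derivative (Polynomial.derivative g))) := by
  -- The first two values of `k` are separate because `d² v^k` involves the exponent `k - 2`.
  rcases k with _ | _ | k
  · simp only [gegenbauerOp, Derivation.map_aeval, Derivation.leibniz, hx, hy, hb, smul_eq_mul,
      pow_zero, map_add, mul_zero, add_zero, zero_add, mul_one,
      Derivation.map_one_eq_zero, Nat.cast_zero]
    ring
  · simp only [gegenbauerOp, Derivation.map_aeval, Derivation.leibniz, Derivation.leibniz_pow, hx,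
      hy, hb, smul_eq_mul, nsmul_eq_mul, map_zero, map_add, map_sub, mul_zero,
      add_zero, zero_add, mul_one, pow_one, Derivation.map_one_eq_zero,
      Derivation.map_natCast]
    push_cast
    simp only [pow_one]
    ring
  · simp only [gegenbauerOp, Derivation.map_aeval, Derivation.leibniz, Derivation.leibniz_pow, hx,
      hy, hb, smul_eq_mul, nsmul_eq_mul, map_zero, map_add, map_sub, mul_zero,
      add_zero, zero_add, mul_one, pow_one, Derivation.map_one_eq_zero,
      Derivation.map_natCast, Nat.add_one_sub_one]
    push_cast
    ring

end GegenbauerOp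

/-! ### The product formula for Gegenbauer polynomials -/

/-- The coefficients `(μ)_{2k} / ((μ + 1/2)_k k!)`. -/
noncomputable def productCoeff (μ : ℂ) (k : ℕ) : ℂ :=
  (ascPochhammer ℂ (2 * k)).eval μ / ((ascPochhammer ℂ k).eval (μ + 1 / 2) * Nat.factorial k)

theorem productCoeff_succ (μ : ℂ) (hμ : ∀ k : ℕ, 2 * μ ≠ -(k : ℂ)) (k : ℕ) :
    productCoeff μ (k + 1) * (4 * (k + 1) * (k + μ + 1 / 2)) =
      productCoeff μ k * (4 * (μ + 2 * k) * (μ + 2 * k + 1)) := by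
  have h1 : μ + 1 / 2 + k ≠ 0 := fun h =>
    hμ (2 * k + 1) (by push_cast; linear_combination 2 * h)
  have h2 : (Nat.factorial k : ℂ) ≠ 0 := by exact_mod_cast Nat.factorial_ne_zero k
  have h3 : (k : ℂ) + 1 ≠ 0 := by exact_mod_cast Nat.succ_ne_zero k
  have h4 : (ascPochhammer ℂ k).eval (μ + 1 / 2) ≠ 0 := by
    rw [Ne, ascPochhammer_eval_eq_zero_iff]
    rintro ⟨j, -, hj⟩
    exact hμ (2 * j + 1) (by push_cast; linear_combination 2 * hj)
  rw [productCoeff, productCoeff, show 2 * (k + 1) = 2 * k + 1 + 1 by ring,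
    ascPochhammer_succ_eval, ascPochhammer_succ_eval, ascPochhammer_succ_eval, Nat.factorial_succ,
    div_mul_eq_mul_div, div_mul_eq_mul_div, div_eq_div_iff]
  · push_cast
    ring
  · exact mul_ne_zero (mul_ne_zero h4 h1) (by exact_mod_cast Nat.factorial_ne_zero (k + 1))
  · exact mul_ne_zero h4 h2

section Product

variable {A : Type*} [CommRing A] [Algebra ℂ A]

/-- One term of the right-hand side of the product formula. -/
noncomputable def productTerm (x y : A) (μ : ℂ) (n k : ℕ) : A :=
  ((1 - x ^ 2) * (1 - y ^ 2)) ^ k *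
    Polynomial.aeval (x * y) (gegenbauerPoly (n - 2 * k) (μ + 2 * k))

/-- The difference of the Gegenbauer operators in `x` and in `y`, applied to
`((1 - x²)(1 - y²))^k g(xy)`. -/
theorem gegenbauerOp_sub_gegenbauerOp (dx dy : Derivation ℂ A A) {x y : A} (hxx : dx x = 1)
    (hxy : dx y = 0) (hyx : dy x = 0) (hyy : dy y = 1) (μ : ℂ) (k : ℕ) (g : Polynomial ℂ) :
    ((1 - x ^ 2) * (1 - y ^ 2)) *
      (gegenbauerOp dx x μ (((1 - x ^ 2) * (1 - y ^ 2)) ^ k * Polynomial.aeval (x * y) g) -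
        gegenbauerOp dy y μ (((1 - x ^ 2) * (1 - y ^ 2)) ^ k * Polynomial.aeval (x * y) g)) =
    (x ^ 2 - y ^ 2) *
      (algebraMap ℂ A (4 * k * (k + μ - 1 / 2)) *
          (((1 - x ^ 2) * (1 - y ^ 2)) ^ k * Polynomial.aeval (x * y) g) -
        ((1 - x ^ 2) * (1 - y ^ 2)) ^ (k + 1) *
          Polynomial.aeval (x * y) (Polynomial.derivative (Polynomial.derivative g))) := by
  have h1 := gegenbauerOp_pow_mul_aeval dx (b := (1 - y ^ 2) ^ k) hxx hxy
    (by simp [Derivation.leibniz_pow, hxy]) μ k g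
  have h2 := gegenbauerOp_pow_mul_aeval dy (b := (1 - x ^ 2) ^ k) hyy hyx
    (by simp [Derivation.leibniz_pow, hyx]) μ k g
  rw [mul_comm y x, mul_comm ((1 - y ^ 2) ^ k)] at h2
  have h3 : algebraMap ℂ A (4 * k * (k + μ - 1 / 2)) =
      4 * k * (k - 1) + 2 * k * algebraMap ℂ A (2 * μ + 1) := by
    rw [show (4 * k * (k + μ - 1 / 2) : ℂ) = 4 * k * (k - 1) + 2 * k * (2 * μ + 1) by ring]
    simp only [map_add, map_sub, map_mul, map_one, map_natCast, map_ofNat]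
  rw [h3]
  simp only [mul_pow]
  linear_combination (1 - y ^ 2) * h1 - (1 - x ^ 2) * h2

theorem derivative_derivative_gegenbauerPoly (m : ℕ) (μ : ℂ) :
    Polynomial.derivative (Polynomial.derivative (gegenbauerPoly (m + 2) μ)) =
      Polynomial.C (4 * μ * (μ + 1)) * gegenbauerPoly m (μ + 2) := by
  rw [derivative_gegenbauerPoly_succ, Polynomial.derivative_C_mul, derivative_gegenbauerPoly_succ,
    ← mul_assoc, ← Polynomial.C_mul, add_assoc, one_add_one_eq_two]
  ring_nf

theorem derivative_derivative_gegenbauerPoly_of_lt {m : ℕ} (hm : m < 2) (μ : ℂ) :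
    Polynomial.derivative (Polynomial.derivative (gegenbauerPoly m μ)) = 0 := by
  interval_cases m
  · simp [gegenbauerPoly]
  · rw [derivative_gegenbauerPoly_succ]
    simp [gegenbauerPoly]

/-- The right-hand side of the product formula is annihilated by the difference of the two
Gegenbauer operators: the contributions of its terms telescope. -/
theorem gegenbauerOp_sum_productTerm [IsDomain A] (dx dy : Derivation ℂ A A) {x y : A}
    (hxx : dx x = 1) (hxy : dx y = 0) (hyx : dy x = 0) (hyy : dy y = 1)
    (hx : 1 - x ^ 2 ≠ 0) (hy : 1 - y ^ 2 ≠ 0) (μ : ℂ) (hμ : ∀ k : ℕ, 2 * μ ≠ -(k : ℂ)) (n : ℕ) :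
    gegenbauerOp dx x μ (∑ k ∈ Finset.range (n / 2 + 1),
        algebraMap ℂ A (productCoeff μ k) * productTerm x y μ n k) =
      gegenbauerOp dy y μ (∑ k ∈ Finset.range (n / 2 + 1),
        algebraMap ℂ A (productCoeff μ k) * productTerm x y μ n k) := by
  rw [← sub_eq_zero, gegenbauerOp_sum, gegenbauerOp_sum, ← Finset.sum_sub_distrib]
  apply (mul_eq_zero_iff_left (mul_ne_zero hx hy)).1
  rw [Finset.mul_sum]
  set T : ℕ → A := fun k =>
    algebraMap ℂ A (productCoeff μ k * (4 * k * (k + μ - 1 / 2))) * productTerm x y μ n k with hT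
  set V : ℕ → A := fun k => algebraMap ℂ A (productCoeff μ k) *
    (((1 - x ^ 2) * (1 - y ^ 2)) ^ (k + 1) * Polynomial.aeval (x * y) (Polynomial.derivative
      (Polynomial.derivative (gegenbauerPoly (n - 2 * k) (μ + 2 * k))))) with hV
  have hterm : ∀ k ∈ Finset.range (n / 2 + 1), (1 - x ^ 2) * (1 - y ^ 2) *
      (gegenbauerOp dx x μ (algebraMap ℂ A (productCoeff μ k) * productTerm x y μ n k) -
        gegenbauerOp dy y μ (algebraMap ℂ A (productCoeff μ k) * productTerm x y μ n k)) =
      (x ^ 2 - y ^ 2) * (T k - V k) := by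
    intro k _
    rw [gegenbauerOp_mul_of_map_eq_zero _ _ _ (dx.map_algebraMap _),
      gegenbauerOp_mul_of_map_eq_zero _ _ _ (dy.map_algebraMap _)]
    have := gegenbauerOp_sub_gegenbauerOp dx dy hxx hxy hyx hyy μ k
      (gegenbauerPoly (n - 2 * k) (μ + 2 * k))
    simp only [hT, hV, map_mul _ (productCoeff μ k)]
    simp only [productTerm]
    linear_combination algebraMap ℂ A (productCoeff μ k) * this
  rw [Finset.sum_congr rfl hterm, ← Finset.mul_sum, Finset.sum_sub_distrib,
    Finset.sum_range_succ' T, Finset.sum_range_succ V]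
  have hT0 : T 0 = 0 := by simp [hT]
  have hVn : V (n / 2) = 0 := by
    simp only [hV]
    rw [derivative_derivative_gegenbauerPoly_of_lt (by omega)]
    simp
  have hTV : ∀ k ∈ Finset.range (n / 2), T (k + 1) = V k := by
    intro k hk
    simp only [Finset.mem_range] at hk
    obtain ⟨m, hm⟩ : ∃ m, n - 2 * k = m + 2 := ⟨n - 2 * k - 2, by omega⟩
    have hm' : n - 2 * (k + 1) = m := by omega
    simp only [hT, hV, productTerm, hm, hm', derivative_derivative_gegenbauerPoly,
      map_mul _ (_ : Polynomial ℂ),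
      Polynomial.aeval_C, Nat.cast_add, Nat.cast_one]
    rw [show productCoeff μ (k + 1) * (4 * ((k : ℂ) + 1) * (k + 1 + μ - 1 / 2)) =
      productCoeff μ k * (4 * (μ + 2 * k) * (μ + 2 * k + 1)) by
        rw [← productCoeff_succ μ hμ k]; ring, show μ + 2 * ((k : ℂ) + 1) = μ + 2 * k + 2 by ring,
        map_mul]
    ring
  rw [hT0, hVn, Finset.sum_congr rfl hTV]
  ring

end Product

/-- If the Gegenbauer operators in `x` and in `y` agree on a multiple of `(y - 1)^(m+1)`, then
`y - 1` divides the cofactor: modulo `(y - 1)^(m+1)`, only the operator in `y` contributes, and it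
contributes `-(m + 1) (2 m + 2 μ + 1) (y - 1)^m` times the cofactor. -/
theorem dvd_of_gegenbauerOp_eq {A : Type*} [CommRing A] [Algebra ℂ A] [IsDomain A]
    (dx dy : Derivation ℂ A A) {x y : A} (hxy : dx y = 0) (hyy : dy y = 1) (hy : y - 1 ≠ 0)
    (μ : ℂ) (hμ : ∀ k : ℕ, 2 * μ ≠ -(k : ℂ)) (m : ℕ) (h : A)
    (heq : gegenbauerOp dx x μ ((y - 1) ^ (m + 1) * h) =
      gegenbauerOp dy y μ ((y - 1) ^ (m + 1) * h)) : y - 1 ∣ h := by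
  rw [gegenbauerOp_mul_of_map_eq_zero _ _ _ (by simp [Derivation.leibniz_pow, hxy])] at heq
  have hc : (m + 1) * (2 * μ + (2 * m + 1 : ℕ)) ≠ 0 :=
    mul_ne_zero (by exact_mod_cast Nat.succ_ne_zero m)
      fun h => hμ (2 * m + 1) (by linear_combination h)
  have hdvd : y - 1 ∣ algebraMap ℂ A ((m + 1) * (2 * μ + (2 * m + 1 : ℕ))) * h := by
    refine ⟨-((y + 1) * (2 * (m + 1) * dy h + (y - 1) * dy (dy h)) + (m + 1) * m * h +
      algebraMap ℂ A (2 * μ + 1) * ((m + 1) * h + y * dy h) + gegenbauerOp dx x μ h), ?_⟩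
    apply mul_left_cancel₀ (pow_ne_zero m hy)
    have hzero : dy (0 : A) = 0 := map_zero dy
    rcases m with _ | m
    · simp only [gegenbauerOp, Derivation.leibniz, map_sub, map_add, hyy,
        Derivation.map_one_eq_zero, smul_eq_mul, zero_add, pow_one, pow_zero, sub_zero,
        mul_one] at heq ⊢
      simp only [map_mul, map_add, map_one, map_ofNat, map_zero, Nat.cast_add, Nat.cast_mul,
        Nat.cast_ofNat, Nat.cast_one, Nat.cast_zero] at heq ⊢
      linear_combination heq
    · simp only [gegenbauerOp, Derivation.leibniz, Derivation.leibniz_pow, map_sub, map_add, hyy,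
        Derivation.map_one_eq_zero, Derivation.map_natCast, smul_eq_mul, nsmul_eq_mul,
        Nat.add_sub_cancel, sub_zero] at heq ⊢
      simp only [map_mul, map_add, map_one, map_ofNat, map_natCast, Nat.cast_add, Nat.cast_mul,
        Nat.cast_ofNat, Nat.cast_one] at heq ⊢
      linear_combination heq
  exact ((IsUnit.mk0 _ hc).map (algebraMap ℂ A)).dvd_mul_left.1 hdvd

theorem sub_dvd_aeval_sub_aeval {A : Type*} [CommRing A] [Algebra ℂ A] (a b : A)
    (P : Polynomial ℂ) : a - b ∣ Polynomial.aeval a P - Polynomial.aeval b P := by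
  simpa [Polynomial.eval_map_algebraMap] using
    Polynomial.sub_dvd_eval_sub a b (P.map (algebraMap ℂ A))

/-- At `y = 1` the product formula reduces to `n! / (2μ)_n C_n^μ(1) = 1`. -/
theorem sub_one_dvd_product_sub_sum {A : Type*} [CommRing A] [Algebra ℂ A] (x y : A) (μ : ℂ)
    (hμ : ∀ k : ℕ, 2 * μ ≠ -(k : ℂ)) (n : ℕ) :
    y - 1 ∣ algebraMap ℂ A ((Nat.factorial n : ℂ) / (ascPochhammer ℂ n).eval (2 * μ)) *
        (Polynomial.aeval x (gegenbauerPoly n μ) * Polynomial.aeval y (gegenbauerPoly n μ)) -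
      ∑ k ∈ Finset.range (n / 2 + 1), algebraMap ℂ A (productCoeff μ k) *
        productTerm x y μ n k := by
  set P := gegenbauerPoly n μ with hP
  set c := (Nat.factorial n : ℂ) / (ascPochhammer ℂ n).eval (2 * μ) with hc
  have hone : algebraMap ℂ A c * Polynomial.aeval 1 P = 1 := by
    have h1 : (Nat.factorial n : ℂ) ≠ 0 := by exact_mod_cast Nat.factorial_ne_zero n
    have h2 : (ascPochhammer ℂ n).eval (2 * μ) ≠ 0 := by
      rw [Ne, ascPochhammer_eval_eq_zero_iff]
      rintro ⟨j, -, hj⟩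
      exact hμ j (by rw [hj, neg_neg])
    rw [← map_one (algebraMap ℂ A), Polynomial.aeval_algebraMap_apply, ← map_mul,
      Polynomial.coe_aeval_eq_eval, hP, gegenbauerPoly_eval_one n μ hμ, hc]
    congr 1
    field_simp
  obtain ⟨u, hu⟩ := sub_dvd_aeval_sub_aeval y 1 P
  obtain ⟨v, hv⟩ := sub_dvd_aeval_sub_aeval (x * y) x P
  have hsum : y - 1 ∣ ∑ k ∈ Finset.range (n / 2),
      algebraMap ℂ A (productCoeff μ (k + 1)) * productTerm x y μ n (k + 1) := by
    refine Finset.dvd_sum fun k _ => Dvd.dvd.mul_left ?_ _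
    refine Dvd.dvd.mul_right ?_ _
    refine Dvd.dvd.trans ?_ (dvd_pow_self _ k.succ_ne_zero)
    exact ⟨-((1 - x ^ 2) * (1 + y)), by ring⟩
  rw [Finset.sum_range_succ']
  obtain ⟨w, hw⟩ := hsum
  rw [hw]
  have h0 : algebraMap ℂ A (productCoeff μ 0) * productTerm x y μ n 0 =
      Polynomial.aeval (x * y) P := by
    simp [productCoeff, productTerm, hP]
  rw [h0]
  refine ⟨algebraMap ℂ A c * Polynomial.aeval x P * u - w - x * v, ?_⟩
  linear_combination (algebraMap ℂ A c * Polynomial.aeval x P) * hu - hv +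
    Polynomial.aeval x P * hone

/-- The product formula as an identity between polynomials in two variables. -/
theorem aeval_gegenbauerPoly_mul_aeval (μ : ℂ) (hμ : ∀ k : ℕ, 2 * μ ≠ -(k : ℂ)) (n : ℕ) :
    algebraMap ℂ (MvPolynomial (Fin 2) ℂ)
        ((Nat.factorial n : ℂ) / (ascPochhammer ℂ n).eval (2 * μ)) *
      (Polynomial.aeval (MvPolynomial.X 0) (gegenbauerPoly n μ) *
        Polynomial.aeval (MvPolynomial.X 1) (gegenbauerPoly n μ)) =
      ∑ k ∈ Finset.range (n / 2 + 1), algebraMap ℂ (MvPolynomial (Fin 2) ℂ) (productCoeff μ k) *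
        productTerm (MvPolynomial.X 0) (MvPolynomial.X 1) μ n k := by
  set dx := MvPolynomial.pderiv (R := ℂ) (0 : Fin 2)
  set dy := MvPolynomial.pderiv (R := ℂ) (1 : Fin 2)
  set x : MvPolynomial (Fin 2) ℂ := MvPolynomial.X 0
  set y : MvPolynomial (Fin 2) ℂ := MvPolynomial.X 1
  have hxx : dx x = 1 := MvPolynomial.pderiv_X_self 0
  have hyy : dy y = 1 := MvPolynomial.pderiv_X_self 1
  have hxy : dx y = 0 := MvPolynomial.pderiv_X_of_ne (by decide)
  have hyx : dy x = 0 := MvPolynomial.pderiv_X_of_ne (by decide)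
  have hx : 1 - x ^ 2 ≠ 0 := fun h => by
    simpa [x] using congrArg (MvPolynomial.eval (0 : Fin 2 → ℂ)) h
  have hy : 1 - y ^ 2 ≠ 0 := fun h => by
    simpa [y] using congrArg (MvPolynomial.eval (0 : Fin 2 → ℂ)) h
  have hy1 : y - 1 ≠ 0 := fun h => by
    simpa [y] using congrArg (MvPolynomial.eval (0 : Fin 2 → ℂ)) h
  have hyu : ¬ IsUnit (y - 1) := fun h => by
    simpa [y] using h.map (MvPolynomial.eval (1 : Fin 2 → ℂ))
  set P := gegenbauerPoly n μ
  set c := (Nat.factorial n : ℂ) / (ascPochhammer ℂ n).eval (2 * μ)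
  set S := ∑ k ∈ Finset.range (n / 2 + 1),
    algebraMap ℂ (MvPolynomial (Fin 2) ℂ) (productCoeff μ k) * productTerm x y μ n k with hS
  rw [← sub_eq_zero]
  by_contra hf
  have hop : gegenbauerOp dx x μ (algebraMap ℂ (MvPolynomial (Fin 2) ℂ) c *
        (Polynomial.aeval x P * Polynomial.aeval y P) - S) =
      gegenbauerOp dy y μ (algebraMap ℂ (MvPolynomial (Fin 2) ℂ) c *
        (Polynomial.aeval x P * Polynomial.aeval y P) - S) := by
    rw [gegenbauerOp_sub, gegenbauerOp_sub,
      gegenbauerOp_sum_productTerm dx dy hxx hxy hyx hyy hx hy μ hμ n]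
    rw [gegenbauerOp_mul_of_map_eq_zero _ _ _ (dx.map_algebraMap _),
      gegenbauerOp_mul_of_map_eq_zero _ _ _ (dy.map_algebraMap _),
      gegenbauerOp_mul_of_map_eq_zero dy _ _ (by rw [Derivation.map_aeval, hyx, smul_zero]),
      gegenbauerOp_aeval_gegenbauerPoly dy hyy, mul_comm (Polynomial.aeval x P),
      gegenbauerOp_mul_of_map_eq_zero dx _ _ (by rw [Derivation.map_aeval, hxy, smul_zero]),
      gegenbauerOp_aeval_gegenbauerPoly dx hxx]
    ring
  have hall : ∀ m : ℕ, (y - 1) ^ (m + 1) ∣ algebraMap ℂ (MvPolynomial (Fin 2) ℂ) c *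
      (Polynomial.aeval x P * Polynomial.aeval y P) - S := by
    intro m
    induction m with
    | zero =>
      rw [zero_add, pow_one]
      exact sub_one_dvd_product_sub_sum x y μ hμ n
    | succ m ih =>
      obtain ⟨h, hh⟩ := ih
      rw [hh] at hop ⊢
      rw [pow_succ _ (m + 1)]
      exact mul_dvd_mul_left _ (dvd_of_gegenbauerOp_eq dx dy hxy hyy hy1 μ hμ m h hop)
  obtain ⟨m, hm⟩ := FiniteMultiplicity.of_not_isUnit hyu hf
  exact hm (hall m)

/-- The product formula for Gegenbauer polynomials: their product at `x` and `y`, expanded in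
Gegenbauer polynomials of shifted parameter at `xy`. -/
theorem gegenbauerC_mul_gegenbauerC (μ : ℂ) (hμ : ∀ k : ℕ, 2 * μ ≠ -(k : ℂ)) (n : ℕ) (x y : ℂ) :
    (Nat.factorial n : ℂ) / (ascPochhammer ℂ n).eval (2 * μ) *
        (gegenbauerC n μ x * gegenbauerC n μ y) =
      ∑ k ∈ Finset.range (n / 2 + 1), productCoeff μ k *
        (((1 - x ^ 2) * (1 - y ^ 2)) ^ k * gegenbauerC (n - 2 * k) (μ + 2 * k) (x * y)) := by
  have hev : ∀ (v : MvPolynomial (Fin 2) ℂ) (P : Polynomial ℂ),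
      MvPolynomial.eval ![x, y] (Polynomial.aeval v P) = P.eval (MvPolynomial.eval ![x, y] v) := by
    intro v P
    have := Polynomial.aeval_algHom_apply (MvPolynomial.aeval (R := ℂ) ![x, y]) v P
    rw [Polynomial.coe_aeval_eq_eval] at this
    simpa using this.symm
  have h := congrArg (MvPolynomial.eval ![x, y]) (aeval_gegenbauerPoly_mul_aeval μ hμ n)
  simpa [productTerm, hev, eval_gegenbauerPoly] using h

/-! ### The generating function of the Gegenbauer polynomials -/

/-- Summing a convergent family along the finite fibres of a map. -/
theorem HasSum.sum_fiber {E β γ : Type*} [NormedAddCommGroup E] [CompleteSpace E] [DecidableEq β]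
    {f : β → E} {a : E} (hf : HasSum f a) (g : β → γ) (s : γ → Finset β)
    (hs : ∀ b c, b ∈ s c ↔ g b = c) : HasSum (fun c => ∑ b ∈ s c, f b) a := by
  convert! hf.tsum_fiberwise g with c
  rw [← Finset.tsum_subtype' (s c) f]
  have : (s c : Set β) = g ⁻¹' {c} := by
    ext b
    simp [hs]
  rw [this]

/-- Summing a convergent double family along `2 k + m = n`. -/
theorem HasSum.sum_two_mul_add {E : Type*} [NormedAddCommGroup E] [CompleteSpace E]
    {f : ℕ × ℕ → E} {a : E} (hf : HasSum f a) :
    HasSum (fun n => ∑ k ∈ Finset.range (n / 2 + 1), f (k, n - 2 * k)) a := by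
  convert! hf.sum_fiber (fun p => 2 * p.1 + p.2)
    (fun n => (Finset.range (n / 2 + 1)).image fun k => (k, n - 2 * k)) ?_ using 2 with n
  · rw [Finset.sum_image fun a _ b _ h => (Prod.ext_iff.1 h).1]
  · rintro ⟨k, m⟩ n
    simp only [Finset.mem_image, Finset.mem_range, Prod.mk.injEq]
    constructor
    · rintro ⟨k, hk, rfl, rfl⟩
      omega
    · intro h
      exact ⟨k, by omega, rfl, by omega⟩

theorem norm_ascPochhammer_eval_le (μ : ℂ) (N : ℕ) (hN : ‖μ‖ ≤ N) (j : ℕ) :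
    ‖(ascPochhammer ℂ j).eval μ‖ ≤ 2 ^ (N + j) * Nat.factorial j := by
  have h1 : ‖(ascPochhammer ℂ j).eval μ‖ ≤ ((ascPochhammer ℕ j).eval N : ℕ) := by
    induction j with
    | zero => simp
    | succ j ih =>
      rw [ascPochhammer_succ_eval, ascPochhammer_succ_eval, norm_mul, Nat.cast_mul]
      refine mul_le_mul ih ?_ (norm_nonneg _) (by positivity)
      refine (norm_add_le _ _).trans ?_
      push_cast
      simpa using hN
  refine h1.trans ?_
  rw [ascPochhammer_nat_eq_ascFactorial, Nat.ascFactorial_eq_factorial_mul_choose', mul_comm]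
  have h2 : (N + j - 1).choose j ≤ 2 ^ (N + j) :=
    (Nat.choose_le_two_pow _ _).trans (Nat.pow_le_pow_right (by norm_num) (by omega))
  exact_mod_cast Nat.mul_le_mul_right _ h2

/-- The terms of the double series obtained by inserting the explicit expression of `C_m^μ(t)`
into `∑ C_m^μ(t) r^m`, indexed by `(l, m - 2 l)`. -/
noncomputable def generatingTerm (μ t r : ℂ) (p : ℕ × ℕ) : ℂ :=
  (ascPochhammer ℂ (p.1 + p.2)).eval μ / ((Nat.factorial p.1 : ℂ) * (Nat.factorial p.2 : ℂ)) *
    ((-(r ^ 2)) ^ p.1 * (2 * t * r) ^ p.2)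

theorem sum_generatingTerm (μ t r : ℂ) (m : ℕ) :
    ∑ l ∈ Finset.range (m / 2 + 1), generatingTerm μ t r (l, m - 2 * l) =
      gegenbauerC m μ t * r ^ m := by
  rw [gegenbauerC, Finset.sum_mul]
  refine Finset.sum_congr rfl fun l hl => ?_
  simp only [Finset.mem_range] at hl
  obtain ⟨i, rfl⟩ : ∃ i, m = 2 * l + i := ⟨m - 2 * l, by omega⟩
  rw [generatingTerm, show 2 * l + i - 2 * l = i by omega, show 2 * l + i - l = l + i by omega,
    neg_pow (r ^ 2), mul_pow _ r, pow_add r, pow_mul r]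
  ring

theorem sum_antidiagonal_generatingTerm (μ t r : ℂ) (j : ℕ) :
    ∑ p ∈ Finset.HasAntidiagonal.antidiagonal j,
      generatingTerm μ t r p =
      (ascPochhammer ℂ j).eval μ / Nat.factorial j * (2 * t * r - r ^ 2) ^ j := by
  rw [sub_eq_neg_add, (Commute.all (-(r ^ 2)) (2 * t * r)).add_pow', Finset.mul_sum]
  refine Finset.sum_congr rfl fun p hp => ?_
  rw [Finset.HasAntidiagonal.mem_antidiagonal] at hp
  subst hp
  have h := Nat.choose_mul_factorial_mul_factorial (Nat.le_add_right p.1 p.2)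
  rw [Nat.add_sub_cancel_left] at h
  have h' : (((p.1 + p.2).choose p.1 : ℕ) : ℂ) * (Nat.factorial p.1 : ℂ) * (Nat.factorial p.2 : ℂ) =
      (Nat.factorial (p.1 + p.2) : ℂ) := by exact_mod_cast h
  have h1 : (Nat.factorial p.1 : ℂ) ≠ 0 := by exact_mod_cast Nat.factorial_ne_zero _
  have h2 : (Nat.factorial p.2 : ℂ) ≠ 0 := by exact_mod_cast Nat.factorial_ne_zero _
  have h3 : (Nat.factorial (p.1 + p.2) : ℂ) ≠ 0 := by exact_mod_cast Nat.factorial_ne_zero _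
  rw [generatingTerm, nsmul_eq_mul]
  have : (ascPochhammer ℂ (p.1 + p.2)).eval μ /
      ((Nat.factorial p.1 : ℂ) * (Nat.factorial p.2 : ℂ)) =
      (ascPochhammer ℂ (p.1 + p.2)).eval μ / Nat.factorial (p.1 + p.2) *
        ((p.1 + p.2).choose p.1 : ℕ) := by
    rw [div_mul_eq_mul_div, div_eq_div_iff (mul_ne_zero h1 h2) h3, ← h']
    ring
  rw [this]
  ring

/-- A product of geometric terms dominates the double series; the factor `2 ^ N` keeps track of the
dependence on `μ`, which is needed when `μ` is shifted by `2 k`. The bound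
`(μ)_{l+i} / (l! i!) ≤ 2^N 4^(l+i)` makes `‖r‖ ≤ 1 / 16` sufficient. -/
theorem norm_generatingTerm_le (μ t r : ℂ) (N : ℕ) (hN : ‖μ‖ ≤ N) (ht : ‖t‖ ≤ 1)
    (hr : ‖r‖ ≤ 1 / 16) (p : ℕ × ℕ) :
    ‖generatingTerm μ t r p‖ ≤ 2 ^ N * ((1 / 2) ^ p.1 * (1 / 2) ^ p.2) := by
  obtain ⟨l, i⟩ := p
  have h1 : (0 : ℝ) < Nat.factorial l := by exact_mod_cast Nat.factorial_pos _
  have h2 : (0 : ℝ) < Nat.factorial i := by exact_mod_cast Nat.factorial_pos _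
  have hcoef : ‖(ascPochhammer ℂ (l + i)).eval μ‖ / ((Nat.factorial l : ℝ) * Nat.factorial i) ≤
      2 ^ N * 4 ^ (l + i) := by
    rw [div_le_iff₀ (mul_pos h1 h2)]
    refine (norm_ascPochhammer_eval_le μ N hN (l + i)).trans ?_
    have h := Nat.choose_mul_factorial_mul_factorial (Nat.le_add_right l i)
    rw [Nat.add_sub_cancel_left] at h
    have h' : (((l + i).choose l : ℕ) : ℝ) * (Nat.factorial l : ℝ) * (Nat.factorial i : ℝ) =
      (Nat.factorial (l + i) : ℝ) := by exact_mod_cast h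
    have h3 : (((l + i).choose l : ℕ) : ℝ) ≤ 2 ^ (l + i) := by
      exact_mod_cast Nat.choose_le_two_pow _ _
    rw [← h', show (4 : ℝ) = 2 * 2 by norm_num, mul_pow (2 : ℝ) 2, pow_add 2 N]
    calc (2 : ℝ) ^ N * 2 ^ (l + i) * (((l + i).choose l : ℕ) * Nat.factorial l * Nat.factorial i)
        ≤ 2 ^ N * 2 ^ (l + i) * (2 ^ (l + i) * Nat.factorial l * Nat.factorial i) := by gcongr
      _ = _ := by ring
  simp only [generatingTerm, norm_mul, norm_div, norm_pow, norm_neg, Complex.norm_natCast,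
    Complex.norm_ofNat]
  have hr0 := norm_nonneg r
  have ha : 4 * ‖r‖ ^ 2 ≤ 1 / 2 := by nlinarith
  have hb : 4 * (2 * ‖t‖ * ‖r‖) ≤ 1 / 2 := by nlinarith [norm_nonneg t]
  calc _ ≤ 2 ^ N * 4 ^ (l + i) * ((‖r‖ ^ 2) ^ l * (2 * ‖t‖ * ‖r‖) ^ i) := by gcongr
    _ = 2 ^ N * ((4 * ‖r‖ ^ 2) ^ l * (4 * (2 * ‖t‖ * ‖r‖)) ^ i) := by
      rw [mul_pow 4, mul_pow 4, pow_add]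
      ring
    _ ≤ _ := by gcongr

theorem hasSum_half_pow_mul_half_pow :
    HasSum (fun p : ℕ × ℕ => (1 / 2 : ℝ) ^ p.1 * (1 / 2) ^ p.2) 4 := by
  have h := hasSum_geometric_two
  have := h.mul h (summable_geometric_two.mul_of_nonneg summable_geometric_two
    (fun _ => by positivity) (fun _ => by positivity))
  norm_num at this ⊢
  exact this

theorem summable_norm_generatingTerm {μ t r : ℂ} (ht : ‖t‖ ≤ 1) (hr : ‖r‖ ≤ 1 / 16) :
    Summable fun p => ‖generatingTerm μ t r p‖ := by
  obtain ⟨N, hN⟩ := exists_nat_ge ‖μ‖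
  exact Summable.of_nonneg_of_le (fun _ => norm_nonneg _)
    (norm_generatingTerm_le μ t r N hN ht hr) (hasSum_half_pow_mul_half_pow.summable.mul_left _)

/-- An absolute bound for the generating series near `0`, with explicit dependence on `μ`. -/
theorem tsum_norm_gegenbauerC_mul_pow_le {μ t r : ℂ} (N : ℕ) (hN : ‖μ‖ ≤ N) (ht : ‖t‖ ≤ 1)
    (hr : ‖r‖ ≤ 1 / 16) :
    Summable (fun m => ‖gegenbauerC m μ t * r ^ m‖) ∧
      ∑' m, ‖gegenbauerC m μ t * r ^ m‖ ≤ 2 ^ N * 4 := by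
  have hs := (hasSum_half_pow_mul_half_pow.mul_left ((2 : ℝ) ^ N)).sum_two_mul_add
  have hle : ∀ m, ‖gegenbauerC m μ t * r ^ m‖ ≤ ∑ k ∈ Finset.range (m / 2 + 1),
      (2 : ℝ) ^ N * ((1 / 2) ^ k * (1 / 2) ^ (m - 2 * k)) := fun m => by
    rw [← sum_generatingTerm]
    exact norm_sum_le_of_le _ fun l _ => norm_generatingTerm_le μ t r N hN ht hr _
  have hsum := Summable.of_nonneg_of_le (fun _ => norm_nonneg _) hle hs.summable
  exact ⟨hsum, (hsum.tsum_le_tsum hle hs.summable).trans_eq hs.tsum_eq⟩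

theorem hasSum_one_div_one_sub_cpow (μ : ℂ) {z : ℂ} (hz : ‖z‖ < 1) :
    HasSum (fun j => (ascPochhammer ℂ j).eval μ / Nat.factorial j * z ^ j)
      (1 / (1 - z) ^ μ) := by
  have h := (Complex.one_div_one_sub_cpow_hasFPowerSeriesOnBall_zero μ).hasSum (y := z)
    (by rw [Metric.mem_eball, edist_zero_right, enorm_eq_nnnorm]; exact_mod_cast hz)
  simp only [zero_add, FormalMultilinearSeries.ofScalars_apply_eq, smul_eq_mul] at h
  suffices he : ∀ j : ℕ, (ascPochhammer ℂ j).eval μ / Nat.factorial j =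
      Ring.choose (μ + j - 1) j by simpa only [he] using h
  intro j
  have h1 : (Nat.factorial j : ℂ) ≠ 0 := by exact_mod_cast Nat.factorial_ne_zero _
  rw [div_eq_iff h1, ← Ring.multichoose_eq, ← Polynomial.ascPochhammer_smeval_eq_eval,
    ← Ring.factorial_nsmul_multichoose_eq_ascPochhammer, nsmul_eq_mul, mul_comm]

/-- The generating function, near `0`. -/
theorem hasSum_gegenbauerC_of_small (μ : ℂ) {t r : ℂ} (ht : ‖t‖ ≤ 1) (hr : ‖r‖ ≤ 1 / 16) :
    HasSum (fun m => gegenbauerC m μ t * r ^ m) (1 / (1 - 2 * t * r + r ^ 2) ^ μ) := by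
  have hs := (summable_norm_generatingTerm (μ := μ) ht hr).of_norm.hasSum
  have h1 := hs.sum_two_mul_add
  have h2 := hs.sum_fiber (fun p => p.1 + p.2) Finset.HasAntidiagonal.antidiagonal
    (fun _ _ => Finset.HasAntidiagonal.mem_antidiagonal)
  simp only [sum_generatingTerm, sum_antidiagonal_generatingTerm] at h1 h2
  have hz : ‖2 * t * r - r ^ 2‖ < 1 := by
    refine (norm_sub_le _ _).trans_lt ?_
    simp only [norm_mul, norm_pow, Complex.norm_ofNat]
    nlinarith [norm_nonneg r, norm_nonneg t]
  have h3 := h2.unique (hasSum_one_div_one_sub_cpow μ hz)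
  rw [h3, show 1 - (2 * t * r - r ^ 2) = 1 - 2 * t * r + r ^ 2 by ring] at h1
  exact h1

theorem one_sub_add_sq_mem_slitPlane {t : ℝ} (ht : t ∈ Set.Icc (-1 : ℝ) 1) {z : ℂ}
    (hz : ‖z‖ < 1) : 1 - 2 * (t : ℂ) * z + z ^ 2 ∈ Complex.slitPlane := by
  rw [Complex.mem_slitPlane_iff]
  have hn : z.re ^ 2 + z.im ^ 2 < 1 := by
    have := Complex.sq_norm z
    rw [Complex.normSq_apply] at this
    nlinarith [norm_nonneg z]
  have hre : (1 - 2 * (t : ℂ) * z + z ^ 2).re = 1 - 2 * t * z.re + (z.re ^ 2 - z.im ^ 2) := by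
    simp [pow_two]
  have him : (1 - 2 * (t : ℂ) * z + z ^ 2).im = 2 * z.im * (z.re - t) := by
    simp [pow_two]
    ring
  rw [hre, him]
  by_cases h : 2 * z.im * (z.re - t) = 0
  · left
    rcases mul_eq_zero.1 h with h | h
    · have : z.im = 0 := by linarith
      rw [this] at hn ⊢
      have h1 : z.re < 1 := by nlinarith
      have h2 : -1 < z.re := by nlinarith
      nlinarith [ht.1, ht.2, mul_nonneg (sub_nonneg.2 ht.2) (sub_nonneg.2 h1.le),
        mul_nonneg (neg_le_iff_add_nonneg.1 ht.1) (sub_nonneg.2 h1.le), sq_nonneg (t - z.re)]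
    · have : t = z.re := by linarith
      rw [this]
      nlinarith
  · exact Or.inr h

/-- On `[-1, 1]` the generating series of the Gegenbauer polynomials converges absolutely in the
whole unit disc, because its sum `(1 - 2tz + z²)^(-μ)` is holomorphic there. -/
theorem summable_norm_gegenbauerC_mul_pow (μ : ℂ) {t : ℝ} (ht : t ∈ Set.Icc (-1 : ℝ) 1) {ρ : ℝ}
    (h0 : 0 ≤ ρ) (h1 : ρ < 1) : Summable fun m => ‖gegenbauerC m μ t‖ * ρ ^ m := by
  obtain ⟨R, hR, hR1⟩ := exists_between h1
  set f : ℂ → ℂ := fun z => 1 / (1 - 2 * (t : ℂ) * z + z ^ 2) ^ μ with hf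
  lift R to NNReal using h0.trans hR.le
  lift ρ to NNReal using h0
  have hd : DifferentiableOn ℂ f (Metric.closedBall 0 R) := by
    intro z hz
    have hz1 : ‖z‖ < 1 := (mem_closedBall_zero_iff.1 hz).trans_lt hR1
    have hs := one_sub_add_sq_mem_slitPlane ht hz1
    refine DifferentiableAt.differentiableWithinAt ?_
    refine (differentiableAt_const _).div ?_ ?_
    · exact DifferentiableAt.cpow (by fun_prop) (by fun_prop) hs
    · rw [Ne, Complex.cpow_eq_zero_iff]
      exact fun h => Complex.slitPlane_ne_zero hs h.1
  have hRpos : 0 < R := lt_of_le_of_lt (zero_le (a := ρ)) (by exact_mod_cast hR)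
  have hps := hd.hasFPowerSeriesOnBall hRpos
  have hat : HasFPowerSeriesAt f (FormalMultilinearSeries.ofScalars ℂ
      fun m => gegenbauerC m μ t) 0 := by
    rw [hasFPowerSeriesAt_iff]
    filter_upwards [Metric.closedBall_mem_nhds (0 : ℂ) (show (0 : ℝ) < 1 / 16 by norm_num)]
      with z hz
    have := hasSum_gegenbauerC_of_small μ (t := (t : ℂ)) (r := z)
      (by rw [Complex.norm_real]; exact abs_le.2 ht) (mem_closedBall_zero_iff.1 hz)
    simpa [hf, mul_comm] using this
  have heq := hat.eq_formalMultilinearSeries hps.hasFPowerSeriesAt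
  have hrad : (ρ : ENNReal) < (FormalMultilinearSeries.ofScalars ℂ
      fun m => gegenbauerC m μ t).radius := by
    rw [heq]
    exact lt_of_lt_of_le (by exact_mod_cast hR) hps.r_le
  have := FormalMultilinearSeries.summable_norm_mul_pow _ hrad
  simpa using this

/-! ### Power series and hypergeometric functions on the unit disc -/

theorem differentiableOn_tsum_mul_pow {a : ℕ → ℂ}
    (ha : ∀ ρ : ℝ, 0 ≤ ρ → ρ < 1 → Summable fun n => ‖a n‖ * ρ ^ n) :
    DifferentiableOn ℂ (fun z => ∑' n, a n * z ^ n) (Metric.ball 0 1) := by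
  intro z hz
  obtain ⟨ρ, hρ, hρ1⟩ := exists_between (mem_ball_zero_iff.1 hz)
  have h := Complex.differentiableOn_tsum_of_summable_norm (F := fun n z => a n * z ^ n)
    (ha ρ ((norm_nonneg z).trans hρ.le) hρ1) (fun n => by fun_prop)
    (Metric.isOpen_ball (x := (0 : ℂ)) (ε := ρ))
    (fun n w hw => by
      rw [norm_mul, norm_pow]
      have := (mem_ball_zero_iff.1 hw).le
      gcongr)
  exact (h.differentiableAt (Metric.isOpen_ball.mem_nhds
    (mem_ball_zero_iff.2 hρ))).differentiableWithinAt

theorem hasSum_deriv_tsum_mul_pow {a : ℕ → ℂ}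
    (ha : ∀ ρ : ℝ, 0 ≤ ρ → ρ < 1 → Summable fun n => ‖a n‖ * ρ ^ n) {z : ℂ} (hz : ‖z‖ < 1) :
    HasSum (fun n : ℕ => n * a n * z ^ n) (z * deriv (fun z => ∑' n, a n * z ^ n) z) := by
  obtain ⟨ρ, hρ, hρ1⟩ := exists_between hz
  have h := Complex.hasSum_deriv_of_summable_norm (F := fun n z => a n * z ^ n)
    (ha ρ ((norm_nonneg z).trans hρ.le) hρ1) (fun n => by fun_prop)
    (Metric.isOpen_ball (x := (0 : ℂ)) (ε := ρ))
    (fun n w hw => by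
      rw [norm_mul, norm_pow]
      have := (mem_ball_zero_iff.1 hw).le
      gcongr) (mem_ball_zero_iff.2 hρ)
  convert! h.mul_left z using 2 with n
  rcases n with _ | n
  · simp
  · simp only [deriv_const_mul_field, deriv_pow_field, Nat.add_sub_cancel]
    ring

theorem hasSum_tsum_mul_pow {a : ℕ → ℂ}
    (ha : ∀ ρ : ℝ, 0 ≤ ρ → ρ < 1 → Summable fun n => ‖a n‖ * ρ ^ n) {z : ℂ} (hz : ‖z‖ < 1) :
    HasSum (fun n : ℕ => a n * z ^ n) (∑' n, a n * z ^ n) := by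
  refine Summable.hasSum (Summable.of_norm ?_)
  simpa using ha ‖z‖ (norm_nonneg z) hz

theorem summable_norm_ordinaryHypergeometricCoefficient {a b c : ℂ}
    (habc : ∀ k : ℕ, (k : ℂ) ≠ -a ∧ (k : ℂ) ≠ -b ∧ (k : ℂ) ≠ -c) (ρ : ℝ) (h0 : 0 ≤ ρ)
    (h1 : ρ < 1) : Summable fun n => ‖ordinaryHypergeometricCoefficient a b c n‖ * ρ ^ n := by
  lift ρ to NNReal using h0
  have hrad : (ρ : ENNReal) < (ordinaryHypergeometricSeries ℂ a b c).radius := by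
    rw [ordinaryHypergeometricSeries_radius_eq_one ℂ a b c habc]
    exact_mod_cast h1
  have := FormalMultilinearSeries.summable_norm_mul_pow _ hrad
  simpa [ordinaryHypergeometricSeries] using this

theorem ordinaryHypergeometric_eq_tsum_coefficient (a b c : ℂ) :
    ordinaryHypergeometric a b c =
      fun z : ℂ => ∑' n, ordinaryHypergeometricCoefficient a b c n * z ^ n := by
  rw [ordinaryHypergeometric_eq_tsum]
  rfl

theorem ascPochhammer_eval_half_mul (μ : ℂ) (k : ℕ) :
    4 ^ k * ((ascPochhammer ℂ k).eval (μ / 2) * (ascPochhammer ℂ k).eval ((μ + 1) / 2)) =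
      (ascPochhammer ℂ (2 * k)).eval μ := by
  induction k with
  | zero => simp
  | succ k ih =>
    rw [show 2 * (k + 1) = 2 * k + 1 + 1 by ring, ascPochhammer_succ_eval (2 * k + 1),
      ascPochhammer_succ_eval (2 * k), ← ih, ascPochhammer_succ_eval, ascPochhammer_succ_eval]
    push_cast
    ring

theorem productCoeff_eq (μ : ℂ) (k : ℕ) :
    productCoeff μ k =
      ordinaryHypergeometricCoefficient (μ / 2) ((μ + 1) / 2) (μ + 1 / 2) k * 4 ^ k := by
  rw [productCoeff, ← ascPochhammer_eval_half_mul]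
  simp only [div_eq_mul_inv, mul_inv]
  ring

section Parameters

variable {μ : ℂ}

theorem natCast_ne_neg_parameters (hμ : ∀ k : ℕ, 2 * μ ≠ -(k : ℂ)) (k : ℕ) :
    (k : ℂ) ≠ -(μ / 2) ∧ (k : ℂ) ≠ -((μ + 1) / 2) ∧ (k : ℂ) ≠ -(μ + 1 / 2) := by
  refine ⟨fun h => hμ (4 * k) ?_, fun h => hμ (4 * k + 2) ?_, fun h => hμ (2 * k + 1) ?_⟩
  · push_cast
    linear_combination (4 : ℂ) * h
  · push_cast
    linear_combination (4 : ℂ) * h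
  · push_cast
    linear_combination (2 : ℂ) * h

theorem natCast_ne_neg_shifted_parameters (hμ : ∀ k : ℕ, 2 * μ ≠ -(k : ℂ)) (k : ℕ) :
    (k : ℂ) ≠ -((μ + 1) / 2) ∧ (k : ℂ) ≠ -((μ + 2) / 2) ∧ (k : ℂ) ≠ -(μ + 1 / 2) := by
  refine ⟨(natCast_ne_neg_parameters hμ k).2.1, fun h => hμ (4 * k + 4) ?_,
    (natCast_ne_neg_parameters hμ k).2.2⟩
  push_cast
  linear_combination (4 : ℂ) * h

/-- Raising the parameter `μ / 2` to `μ / 2 + 1` by a first order differential operator. -/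
theorem mul_ordinaryHypergeometric_add_deriv (hμ : ∀ k : ℕ, 2 * μ ≠ -(k : ℂ)) {z : ℂ}
    (hz : ‖z‖ < 1) :
    μ * ordinaryHypergeometric (μ / 2) ((μ + 1) / 2) (μ + 1 / 2) z +
        2 * (z * deriv (ordinaryHypergeometric (μ / 2) ((μ + 1) / 2) (μ + 1 / 2)) z) =
      μ * ordinaryHypergeometric ((μ + 1) / 2) ((μ + 2) / 2) (μ + 1 / 2) z := by
  simp only [ordinaryHypergeometric_eq_tsum_coefficient]
  have h1 := summable_norm_ordinaryHypergeometricCoefficient (natCast_ne_neg_parameters hμ)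
  have h2 := summable_norm_ordinaryHypergeometricCoefficient (natCast_ne_neg_shifted_parameters hμ)
  have hl := ((hasSum_tsum_mul_pow h1 hz).mul_left μ).add
    ((hasSum_deriv_tsum_mul_pow h1 hz).mul_left 2)
  refine hl.unique ?_
  convert! (hasSum_tsum_mul_pow h2 hz).mul_left μ using 2 with n
  have h3 : (μ / 2 + n) * (ascPochhammer ℂ n).eval (μ / 2) =
      μ / 2 * (ascPochhammer ℂ n).eval ((μ + 2) / 2) := by
    rw [mul_comm, ← ascPochhammer_succ_eval, ascPochhammer_eval_succ_left,
      show μ / 2 + 1 = (μ + 2) / 2 by ring]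
  simp only [ordinaryHypergeometricCoefficient]
  linear_combination (2 * (Nat.factorial n : ℂ)⁻¹ * (ascPochhammer ℂ n).eval ((μ + 1) / 2) *
    ((ascPochhammer ℂ n).eval (μ + 1 / 2))⁻¹ * z ^ n) * h3

end Parameters

/-! ### The first identity near the origin -/

/-- The coefficients `n! / (2μ)_n C_n^μ(x) C_n^μ(y)` of the bilinear generating function. -/
noncomputable def bilinearCoeff (μ x y : ℂ) (n : ℕ) : ℂ :=
  (Nat.factorial n : ℂ) / (ascPochhammer ℂ n).eval (2 * μ) *
    (gegenbauerC n μ x * gegenbauerC n μ y)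

/-- For small `r` the double series obtained by expanding each `(1 - 2xyr + r²)^(-μ-2k)` into
Gegenbauer polynomials converges absolutely, and by the product formula its terms of degree `n` in
`r` sum to the `n`-th term of the bilinear generating function. -/
theorem hasSum_bilinearCoeff_of_small {μ : ℂ} (hμ : ∀ k : ℕ, 2 * μ ≠ -(k : ℂ)) {x y r : ℂ}
    (hxy : ‖x * y‖ ≤ 1) (hw : ‖(1 - x ^ 2) * (1 - y ^ 2)‖ ≤ 1) (hr : ‖r‖ ≤ 1 / 16) :
    HasSum (fun n => bilinearCoeff μ x y n * r ^ n)
      (1 / (1 - 2 * (x * y) * r + r ^ 2) ^ μ *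
        ordinaryHypergeometric (μ / 2) ((μ + 1) / 2) (μ + 1 / 2)
          (4 * r ^ 2 * ((1 - x ^ 2) * (1 - y ^ 2)) / (1 - 2 * (x * y) * r + r ^ 2) ^ 2)) := by
  set w := (1 - x ^ 2) * (1 - y ^ 2) with hwdef
  set t := x * y with ht
  set D := 1 - 2 * t * r + r ^ 2 with hD
  obtain ⟨c, hpc, hcoef, hFeq⟩ : ∃ c : ℕ → ℂ, (∀ k, productCoeff μ k = c k * 4 ^ k) ∧
      (∀ ρ : ℝ, 0 ≤ ρ → ρ < 1 → Summable fun n => ‖c n‖ * ρ ^ n) ∧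
      ∀ z, ordinaryHypergeometric (μ / 2) ((μ + 1) / 2) (μ + 1 / 2) z = ∑' n, c n * z ^ n :=
    ⟨_, productCoeff_eq μ,
      summable_norm_ordinaryHypergeometricCoefficient (natCast_ne_neg_parameters hμ),
      fun z => congrFun (ordinaryHypergeometric_eq_tsum_coefficient _ _ _) z⟩
  rw [hFeq]
  set f : ℕ × ℕ → ℂ := fun p => productCoeff μ p.1 * (w * r ^ 2) ^ p.1 *
    (gegenbauerC p.2 (μ + 2 * p.1) t * r ^ p.2) with hf
  obtain ⟨N, hN⟩ := exists_nat_ge ‖μ‖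
  have hbound : ∀ k : ℕ, Summable (fun m => ‖gegenbauerC m (μ + 2 * k) t * r ^ m‖) ∧
      ∑' m, ‖gegenbauerC m (μ + 2 * k) t * r ^ m‖ ≤ 2 ^ (N + 2 * k) * 4 := fun k => by
    refine tsum_norm_gegenbauerC_mul_pow_le (N + 2 * k) ?_ hxy hr
    refine (norm_add_le _ _).trans ?_
    push_cast
    simpa using hN
  have hr0 := norm_nonneg r
  have hfs : Summable f := by
    refine Summable.of_norm ((summable_prod_of_nonneg fun _ => norm_nonneg _).2 ⟨fun k => ?_, ?_⟩)
    · simp only [hf, norm_mul (_ * _ : ℂ) (_ * _ : ℂ)]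
      exact (hbound k).1.mul_left _
    · refine Summable.of_nonneg_of_le (fun k => tsum_nonneg fun _ => norm_nonneg _) (fun k => ?_)
        ((hcoef (1 / 16) (by norm_num) (by norm_num)).mul_left (2 ^ N * 4))
      simp only [hf, norm_mul (_ * _ : ℂ) (_ * _ : ℂ)]
      rw [tsum_mul_left, hpc]
      calc _ ≤ ‖c k * 4 ^ k *
              (w * r ^ 2) ^ k‖ * (2 ^ (N + 2 * k) * 4) := by
            gcongr
            exact (hbound k).2
        _ = 2 ^ N * 4 * (‖c k‖ *
              (16 * ‖w‖ * ‖r‖ ^ 2) ^ k) := by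
            rw [norm_mul, norm_mul, norm_pow, norm_pow, norm_mul, norm_pow, Complex.norm_ofNat,
              show (16 : ℝ) = 4 * 2 ^ 2 by norm_num, pow_add, pow_mul]
            simp only [mul_pow]
            ring
        _ ≤ _ := by
            have h1 : ‖w‖ * ‖r‖ ^ 2 ≤ 1 * (1 / 16) ^ 2 :=
              mul_le_mul hw (pow_le_pow_left₀ hr0 hr 2) (by positivity) zero_le_one
            gcongr
            linarith
  have hDn : 4 / 5 ≤ ‖D‖ := by
    have h1 : ‖2 * t * r - r ^ 2‖ ≤ 1 / 5 := by
      refine (norm_sub_le _ _).trans ?_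
      rw [norm_mul, norm_mul, norm_pow, Complex.norm_ofNat]
      have h2 : ‖t‖ * ‖r‖ ≤ 1 * (1 / 16) := mul_le_mul hxy hr hr0 zero_le_one
      have h3 : ‖r‖ ^ 2 ≤ (1 / 16) ^ 2 := pow_le_pow_left₀ hr0 hr 2
      linarith
    have h4 := norm_add_le D (2 * t * r - r ^ 2)
    rw [show D + (2 * t * r - r ^ 2) = 1 by rw [hD]; ring, norm_one] at h4
    linarith
  have hDne : D ≠ 0 := norm_pos_iff.1 (by linarith)
  have hZ : ‖4 * r ^ 2 * w / D ^ 2‖ < 1 := by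
    rw [norm_div, norm_mul, norm_mul, norm_pow, norm_pow, Complex.norm_ofNat,
      div_lt_one (by positivity)]
    have h1 : ‖r‖ ^ 2 * ‖w‖ ≤ (1 / 16) ^ 2 * 1 :=
      mul_le_mul (pow_le_pow_left₀ hr0 hr 2) hw (norm_nonneg w) (by norm_num)
    have h2 : (4 / 5 : ℝ) ^ 2 ≤ ‖D‖ ^ 2 := pow_le_pow_left₀ (by norm_num) hDn 2
    linarith
  have hL : HasSum (fun n => bilinearCoeff μ x y n * r ^ n) (∑' p, f p) := by
    convert! hfs.hasSum.sum_two_mul_add using 2 with n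
    rw [bilinearCoeff, gegenbauerC_mul_gegenbauerC μ hμ, Finset.sum_mul]
    refine Finset.sum_congr rfl fun k hk => ?_
    simp only [Finset.mem_range] at hk
    obtain ⟨m, rfl⟩ : ∃ m, n = 2 * k + m := ⟨n - 2 * k, by omega⟩
    simp only [hf]
    rw [show 2 * k + m - 2 * k = m by omega, pow_add r, pow_mul r, mul_pow w]
    ring
  have hR : HasSum (fun k : ℕ => productCoeff μ k * (w * r ^ 2) ^ k * (1 / D ^ (μ + 2 * k)))
      (∑' p, f p) := by
    refine HasSum.prod_fiberwise hfs.hasSum fun k => ?_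
    have hk := hasSum_gegenbauerC_of_small (μ + 2 * k) hxy hr
    exact hk.mul_left (productCoeff μ k * (w * r ^ 2) ^ k)
  have hF := (hasSum_tsum_mul_pow hcoef hZ).mul_left (1 / D ^ μ)
  convert hL using 1
  refine hF.unique ?_
  convert! hR using 2 with k
  have h1 : D ^ (μ + 2 * k) = D ^ μ * D ^ (2 * k) := by
    rw [Complex.cpow_add _ _ hDne, ← Complex.cpow_natCast D (2 * k)]
    push_cast
    rfl
  have h2 : D ^ μ ≠ 0 := by
    rw [Ne, Complex.cpow_eq_zero_iff]
    exact fun h => hDne h.1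
  rw [h1, hpc, div_pow, mul_pow _ w, mul_pow w, mul_pow 4, ← pow_mul D 2 k]
  field_simp

/-! ### Continuation to the whole interval -/

section RealEstimates

variable {r x y : ℝ}

theorem abs_mul_le_one_of_mem_Icc (hx : x ∈ Set.Icc (-1 : ℝ) 1) (hy : y ∈ Set.Icc (-1 : ℝ) 1) :
    |x * y| ≤ 1 := by
  rw [abs_mul]
  exact mul_le_one₀ (abs_le.2 hx) (abs_nonneg y) (abs_le.2 hy)

theorem one_sub_two_mul_add_sq_pos (hr : r ∈ Set.Ioo (-1 : ℝ) 1) (hx : x ∈ Set.Icc (-1 : ℝ) 1)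
    (hy : y ∈ Set.Icc (-1 : ℝ) 1) : 0 < 1 - 2 * r * x * y + r ^ 2 := by
  have h1 : r * (x * y) ≤ |r| := by
    refine (le_abs_self _).trans ?_
    rw [abs_mul]
    exact mul_le_of_le_one_right (abs_nonneg r) (abs_mul_le_one_of_mem_Icc hx hy)
  have h2 : |r| < 1 := abs_lt.2 hr
  have h3 : 0 < (1 - |r|) ^ 2 := pow_pos (by linarith) 2
  have h4 : (1 - |r|) ^ 2 = 1 - 2 * |r| + r ^ 2 := by
    rw [← sq_abs r]
    ring
  nlinarith

/-- The quotient is less than `1` because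
`(1 - 2rxy + r²)² - 4r²(1 - x²)(1 - y²) ≥ (1 - |r|)⁴`. -/
theorem quotient_mem_Ico (hr : r ∈ Set.Ioo (-1 : ℝ) 1) (hx : x ∈ Set.Icc (-1 : ℝ) 1)
    (hy : y ∈ Set.Icc (-1 : ℝ) 1) :
    4 * r ^ 2 * (1 - x ^ 2) * (1 - y ^ 2) / (1 - 2 * r * x * y + r ^ 2) ^ 2 ∈
      Set.Ico (0 : ℝ) 1 := by
  have hD := one_sub_two_mul_add_sq_pos hr hx hy
  have hx2 : x ^ 2 ≤ 1 := (sq_le_one_iff_abs_le_one x).2 (abs_le.2 hx)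
  have hy2 : y ^ 2 ≤ 1 := (sq_le_one_iff_abs_le_one y).2 (abs_le.2 hy)
  have hx3 : 0 ≤ 1 - x ^ 2 := by linarith
  have hy3 : 0 ≤ 1 - y ^ 2 := by linarith
  refine ⟨by positivity, ?_⟩
  rw [div_lt_one (by positivity)]
  set q := |r| with hq
  set u := |x * y| with hu
  have hq0 : 0 ≤ q := abs_nonneg r
  have hq1 : q < 1 := abs_lt.2 hr
  have hu1 : u ≤ 1 := abs_mul_le_one_of_mem_Icc hx hy
  have hrq : r ^ 2 = q ^ 2 := (sq_abs r).symm
  have h1 : r * (x * y) ≤ q * u := by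
    rw [hq, hu, ← abs_mul]
    exact le_abs_self _
  have h2 : 2 * u ≤ x ^ 2 + y ^ 2 := by
    rw [hu, abs_mul, ← sq_abs x, ← sq_abs y]
    linarith [two_mul_le_add_sq |x| |y|]
  have h3 : 0 < (1 - q) ^ 4 := pow_pos (by linarith) 4
  have h4 : 0 ≤ 4 * q * (1 - q) ^ 2 * (1 - u) :=
    mul_nonneg (by positivity) (by linarith)
  have h5 : 0 ≤ 4 * (1 + q ^ 2) * (q * u - r * (x * y)) :=
    mul_nonneg (by positivity) (by linarith)
  have h6 : 0 ≤ 4 * q ^ 2 * (x ^ 2 + y ^ 2 - 2 * u) :=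
    mul_nonneg (by positivity) (by linarith)
  have hid : (1 - 2 * r * x * y + r ^ 2) ^ 2 - 4 * r ^ 2 * (1 - x ^ 2) * (1 - y ^ 2) =
      (1 - q) ^ 4 + 4 * q * (1 - q) ^ 2 * (1 - u) +
        4 * (1 + q ^ 2) * (q * u - r * (x * y)) + 4 * q ^ 2 * (x ^ 2 + y ^ 2 - 2 * u) := by
    linear_combination (-2 + 4 * x ^ 2 + 4 * y ^ 2 + r ^ 2 + q ^ 2 - 4 * r * x * y) * hrq
  linarith

end RealEstimates

theorem summable_mul_of_nonneg {f g : ℕ → ℝ} (hf0 : ∀ n, 0 ≤ f n) (hg0 : ∀ n, 0 ≤ g n)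
    (hf : Summable f) (hg : Summable g) : Summable fun n => f n * g n :=
  (hf.mul_of_nonneg hg hf0 hg0).comp_injective (i := fun n : ℕ => (n, n))
    fun _ _ h => (Prod.ext_iff.1 h).1

theorem summable_norm_bilinearCoeff {μ : ℂ} (hμ : ∀ k : ℕ, 2 * μ ≠ -(k : ℂ)) {x y : ℝ}
    (hx : x ∈ Set.Icc (-1 : ℝ) 1) (hy : y ∈ Set.Icc (-1 : ℝ) 1) (ρ : ℝ) (h0 : 0 ≤ ρ)
    (h1 : ρ < 1) : Summable fun n => ‖bilinearCoeff μ x y n‖ * ρ ^ n := by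
  -- A cube root of `ρ` shares out the geometric factor among the three factors of the coefficient.
  obtain ⟨σ, hσ0, hσ1, rfl⟩ : ∃ σ : ℝ, 0 ≤ σ ∧ σ < 1 ∧ σ ^ 3 = ρ := by
    refine ⟨ρ ^ ((3 : ℕ) : ℝ)⁻¹, by positivity, Real.rpow_lt_one h0 h1 (by positivity), ?_⟩
    exact Real.rpow_inv_natCast_pow h0 (by norm_num)
  -- `n! / (2μ)_n` is the `n`-th coefficient of `₂F₁(1, 1; 2μ; z)`.
  have hc := summable_norm_ordinaryHypergeometricCoefficient (a := 1) (b := 1) (c := 2 * μ)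
    (fun k => by
      have hk : (k : ℂ) ≠ -1 := by
        intro h
        have : ((k + 1 : ℕ) : ℂ) = 0 := by
          push_cast
          rw [h]
          ring
        exact Nat.succ_ne_zero k (by exact_mod_cast this)
      exact ⟨hk, hk, fun h => hμ k (by rw [h, neg_neg])⟩) σ hσ0 hσ1
  have hxs := summable_norm_gegenbauerC_mul_pow μ hx hσ0 hσ1
  have hys := summable_norm_gegenbauerC_mul_pow μ hy hσ0 hσ1
  have hxy : Summable fun n => (‖gegenbauerC n μ x‖ * σ ^ n) * (‖gegenbauerC n μ y‖ * σ ^ n) :=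
    summable_mul_of_nonneg (fun _ => by positivity) (fun _ => by positivity) hxs hys
  have := summable_mul_of_nonneg (fun _ => by positivity) (fun _ => by positivity) hc hxy
  refine this.congr fun n => ?_
  have hn : (Nat.factorial n : ℂ) ≠ 0 := by exact_mod_cast Nat.factorial_ne_zero n
  rw [bilinearCoeff, ordinaryHypergeometricCoefficient, ascPochhammer_eval_one,
    inv_mul_cancel₀ hn, one_mul, ← div_eq_mul_inv, norm_mul, norm_mul]
  ring

/-- The closed form of the first series, with a complex variable `z` in place of `r`. -/
noncomputable def gegenbauerKernel (μ x y z : ℂ) : ℂ :=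
  1 / (1 - 2 * (x * y) * z + z ^ 2) ^ μ *
    ordinaryHypergeometric (μ / 2) ((μ + 1) / 2) (μ + 1 / 2)
      (4 * z ^ 2 * ((1 - x ^ 2) * (1 - y ^ 2)) / (1 - 2 * (x * y) * z + z ^ 2) ^ 2)

/-- Applying `μ + z d/dz` to the closed form of the first series gives `μ` times the closed form of
the second. -/
theorem hasDerivAt_gegenbauerKernel {μ x y z : ℂ} (hμ : ∀ k : ℕ, 2 * μ ≠ -(k : ℂ))
    (hD : 1 - 2 * (x * y) * z + z ^ 2 ∈ Complex.slitPlane)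
    (hZ : ‖4 * z ^ 2 * ((1 - x ^ 2) * (1 - y ^ 2)) / (1 - 2 * (x * y) * z + z ^ 2) ^ 2‖ < 1) :
    ∃ d, HasDerivAt (gegenbauerKernel μ x y) d z ∧
      μ * gegenbauerKernel μ x y z + z * d =
        μ * ((1 - z ^ 2) / (1 - 2 * (x * y) * z + z ^ 2) ^ (μ + 1) *
          ordinaryHypergeometric ((μ + 1) / 2) ((μ + 2) / 2) (μ + 1 / 2)
            (4 * z ^ 2 * ((1 - x ^ 2) * (1 - y ^ 2)) / (1 - 2 * (x * y) * z + z ^ 2) ^ 2)) := by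
  have hF := mul_ordinaryHypergeometric_add_deriv hμ hZ
  set F := ordinaryHypergeometric (𝔸 := ℂ) (μ / 2) ((μ + 1) / 2) (μ + 1 / 2) with hFdef
  set G := ordinaryHypergeometric (𝔸 := ℂ) ((μ + 1) / 2) ((μ + 2) / 2) (μ + 1 / 2)
  set t := x * y with ht
  set w := (1 - x ^ 2) * (1 - y ^ 2) with hw
  have hK : ∀ v, gegenbauerKernel μ x y v = 1 / (1 - 2 * t * v + v ^ 2) ^ μ *
      F (4 * v ^ 2 * w / (1 - 2 * t * v + v ^ 2) ^ 2) := fun _ => rfl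
  have hDne := Complex.slitPlane_ne_zero hD
  have hFd : HasDerivAt F (deriv F (4 * z ^ 2 * w / (1 - 2 * t * z + z ^ 2) ^ 2))
      (4 * z ^ 2 * w / (1 - 2 * t * z + z ^ 2) ^ 2) := by
    have h := differentiableOn_tsum_mul_pow
      (summable_norm_ordinaryHypergeometricCoefficient (natCast_ne_neg_parameters hμ))
    rw [hFdef, ordinaryHypergeometric_eq_tsum_coefficient]
    exact (h.differentiableAt (Metric.isOpen_ball.mem_nhds (mem_ball_zero_iff.2 hZ))).hasDerivAt
  have hDd : HasDerivAt (fun z : ℂ => 1 - 2 * t * z + z ^ 2) (2 * z - 2 * t) z := by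
    have := (((hasDerivAt_id z).const_mul (2 * t)).const_sub 1).add (hasDerivAt_pow 2 z)
    convert! this using 1
    push_cast
    ring
  have hZd : HasDerivAt (fun z : ℂ => 4 * z ^ 2 * w / (1 - 2 * t * z + z ^ 2) ^ 2) _ z :=
    (((hasDerivAt_pow 2 z).const_mul 4).mul_const w).div (hDd.pow 2) (pow_ne_zero 2 hDne)
  have hPd := (hDd.cpow_const (c := -μ) hD).mul (hFd.comp z hZd)
  refine ⟨_, hPd.congr_of_eventuallyEq ?_, ?_⟩
  · refine Filter.Eventually.of_forall fun z => ?_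
    rw [hK, Pi.mul_apply, Function.comp_apply, Complex.cpow_neg, one_div]
  · rw [hK]
    set D := 1 - 2 * t * z + z ^ 2 with hDdef
    set dF := deriv F (4 * z ^ 2 * w / D ^ 2)
    have hDμ : D ^ μ ≠ 0 := by
      rw [Ne, Complex.cpow_eq_zero_iff]
      exact fun h => hDne h.1
    have h1 : D ^ (μ + 1) = D ^ μ * D := by rw [Complex.cpow_add _ _ hDne, Complex.cpow_one]
    have h2 : D ^ (-μ - 1) = (D ^ μ * D)⁻¹ := by
      rw [← h1, ← Complex.cpow_neg]
      ring_nf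
    have h3 : D ^ (-μ) = (D ^ μ)⁻¹ := Complex.cpow_neg _ _
    -- `D - z D' = 1 - z²` turns the logarithmic derivatives of `D^(-μ)` and of the argument
    -- into the common factor `(1 - z²) / D`.
    have hrel : 1 - z ^ 2 = D - z * (2 * z - 2 * t) := by
      rw [hDdef]
      ring
    simp only [Function.comp_apply]
    rw [← hDdef, h1, h2, h3, hrel]
    clear_value dF D
    have hFG : μ * F (4 * z ^ 2 * w / D ^ 2) + 2 * (4 * z ^ 2 * w / D ^ 2 * dF) =
      μ * G (4 * z ^ 2 * w / D ^ 2) := hF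
    generalize F (4 * z ^ 2 * w / D ^ 2) = F0 at *
    generalize G (4 * z ^ 2 * w / D ^ 2) = G0 at *
    generalize D ^ μ = P at *
    rw [mul_left_comm μ _ G0, ← hFG]
    push_cast
    field_simp
    ring

theorem kernel_denominator_mem_slitPlane {r x y : ℝ} (hr : r ∈ Set.Ioo (-1 : ℝ) 1)
    (hx : x ∈ Set.Icc (-1 : ℝ) 1) (hy : y ∈ Set.Icc (-1 : ℝ) 1) :
    1 - 2 * ((x : ℂ) * y) * r + (r : ℂ) ^ 2 ∈ Complex.slitPlane := by
  have h := one_sub_two_mul_add_sq_pos hr hx hy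
  rw [show 1 - 2 * ((x : ℂ) * y) * r + (r : ℂ) ^ 2 = ((1 - 2 * r * x * y + r ^ 2 : ℝ) : ℂ) by
    push_cast
    ring]
  exact Complex.ofReal_mem_slitPlane.2 h

theorem norm_kernel_argument_lt_one {r x y : ℝ} (hr : r ∈ Set.Ioo (-1 : ℝ) 1)
    (hx : x ∈ Set.Icc (-1 : ℝ) 1) (hy : y ∈ Set.Icc (-1 : ℝ) 1) :
    ‖4 * (r : ℂ) ^ 2 * ((1 - (x : ℂ) ^ 2) * (1 - (y : ℂ) ^ 2)) /
      (1 - 2 * ((x : ℂ) * y) * r + (r : ℂ) ^ 2) ^ 2‖ < 1 := by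
  have h := quotient_mem_Ico hr hx hy
  rw [show 4 * (r : ℂ) ^ 2 * ((1 - (x : ℂ) ^ 2) * (1 - (y : ℂ) ^ 2)) /
      (1 - 2 * ((x : ℂ) * y) * r + (r : ℂ) ^ 2) ^ 2 =
      ((4 * r ^ 2 * (1 - x ^ 2) * (1 - y ^ 2) / (1 - 2 * r * x * y + r ^ 2) ^ 2 : ℝ) : ℂ) by
    push_cast
    ring_nf, Complex.norm_real, Real.norm_of_nonneg h.1]
  exact h.2

theorem analyticAt_gegenbauerKernel {μ : ℂ} (hμ : ∀ k : ℕ, 2 * μ ≠ -(k : ℂ)) {r x y : ℝ}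
    (hr : r ∈ Set.Ioo (-1 : ℝ) 1) (hx : x ∈ Set.Icc (-1 : ℝ) 1) (hy : y ∈ Set.Icc (-1 : ℝ) 1) :
    AnalyticAt ℂ (gegenbauerKernel μ x y) r := by
  have hD := kernel_denominator_mem_slitPlane hr hx hy
  have hDne := Complex.slitPlane_ne_zero hD
  have hden : AnalyticAt ℂ (fun z : ℂ => 1 - 2 * ((x : ℂ) * y) * z + z ^ 2) r := by fun_prop
  have hF := (differentiableOn_tsum_mul_pow (summable_norm_ordinaryHypergeometricCoefficient
    (natCast_ne_neg_parameters hμ))).analyticOnNhd Metric.isOpen_ball _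
      (mem_ball_zero_iff.2 (norm_kernel_argument_lt_one hr hx hy))
  rw [← ordinaryHypergeometric_eq_tsum_coefficient] at hF
  refine AnalyticAt.mul (analyticAt_const.div (hden.cpow analyticAt_const hD) ?_) ?_
  · rw [Ne, Complex.cpow_eq_zero_iff]
    exact fun h => hDne h.1
  · refine AnalyticAt.fun_comp hF ?_
    exact AnalyticAt.div (by fun_prop) (hden.pow 2) (pow_ne_zero 2 hDne)

/-- The first identity. Both sides are real-analytic in `r ∈ (-1, 1)` and agree near `0`. -/
theorem tsum_bilinearCoeff_eq_gegenbauerKernel {μ : ℂ} (hμ : ∀ k : ℕ, 2 * μ ≠ -(k : ℂ)) {x y : ℝ}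
    (hx : x ∈ Set.Icc (-1 : ℝ) 1) (hy : y ∈ Set.Icc (-1 : ℝ) 1) :
    Set.EqOn (fun r : ℝ => ∑' n, bilinearCoeff μ x y n * (r : ℂ) ^ n)
      (fun r : ℝ => gegenbauerKernel μ x y r) (Set.Ioo (-1 : ℝ) 1) := by
  have hsum := summable_norm_bilinearCoeff hμ hx hy
  have hre : AnalyticOnNhd ℝ (fun r : ℝ => (r : ℂ)) (Set.Ioo (-1 : ℝ) 1) :=
    fun r _ => Complex.ofRealCLM.analyticAt r
  refine AnalyticOnNhd.eqOn_of_preconnected_of_eventuallyEq (𝕜 := ℝ) (z₀ := 0) (fun r hr => ?_)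
    (fun r hr => ?_) isPreconnected_Ioo (by norm_num) ?_
  · have h := (differentiableOn_tsum_mul_pow hsum).analyticOnNhd Metric.isOpen_ball (r : ℂ)
      (by rw [mem_ball_zero_iff, Complex.norm_real]; exact abs_lt.2 hr)
    exact (h.restrictScalars (𝕜 := ℝ)).comp (hre r hr)
  · have h : AnalyticAt ℂ (gegenbauerKernel μ x y) r :=
      analyticAt_gegenbauerKernel hμ hr hx hy
    exact (h.restrictScalars (𝕜 := ℝ)).comp (hre r hr)
  · filter_upwards [Metric.closedBall_mem_nhds (0 : ℝ) (show (0 : ℝ) < 1 / 16 by norm_num)]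
      with r hr
    refine (hasSum_bilinearCoeff_of_small hμ ?_ ?_ ?_).tsum_eq
    · rw [← Complex.ofReal_mul, Complex.norm_real]
      exact abs_mul_le_one_of_mem_Icc hx hy
    · have hx2 : x ^ 2 ≤ 1 := (sq_le_one_iff_abs_le_one x).2 (abs_le.2 hx)
      have hy2 : y ^ 2 ≤ 1 := (sq_le_one_iff_abs_le_one y).2 (abs_le.2 hy)
      have : |(1 - x ^ 2) * (1 - y ^ 2)| ≤ 1 :=
        abs_mul_le_one_of_mem_Icc ⟨by linarith, by linarith [sq_nonneg x]⟩
          ⟨by linarith, by linarith [sq_nonneg y]⟩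
      exact_mod_cast this
    · rw [Complex.norm_real]
      exact mem_closedBall_zero_iff.1 hr

theorem mainTheorem2 (lam : ℂ) (hlam : ∀ k : ℕ, 2 * lam ≠ -(k : ℂ))
    (r x y : ℝ) (hr : r ∈ Set.Ioo (-1 : ℝ) 1)
    (hx : x ∈ Set.Icc (-1 : ℝ) 1) (hy : y ∈ Set.Icc (-1 : ℝ) 1) :
    0 < 1 - 2 * r * x * y + r ^ 2 ∧
    4 * r ^ 2 * (1 - x ^ 2) * (1 - y ^ 2) / (1 - 2 * r * x * y + r ^ 2) ^ 2 ∈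
      Set.Ico (0 : ℝ) 1 ∧
    HasSum
      (fun n : ℕ => (Nat.factorial n : ℂ) / (ascPochhammer ℂ n).eval (2 * lam) *
        (r : ℂ) ^ n * gegenbauerC n lam (x : ℂ) * gegenbauerC n lam (y : ℂ))
      (1 / ((1 - 2 * r * x * y + r ^ 2 : ℝ) : ℂ) ^ lam *
        ordinaryHypergeometric (lam / 2) ((lam + 1) / 2) (lam + 1 / 2)
          ((4 * r ^ 2 * (1 - x ^ 2) * (1 - y ^ 2) /
            (1 - 2 * r * x * y + r ^ 2) ^ 2 : ℝ) : ℂ)) ∧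
    HasSum
      (fun n : ℕ => (lam + n) / lam *
        ((Nat.factorial n : ℂ) / (ascPochhammer ℂ n).eval (2 * lam)) *
        (r : ℂ) ^ n * gegenbauerC n lam (x : ℂ) * gegenbauerC n lam (y : ℂ))
      (((1 - r ^ 2 : ℝ) : ℂ) / ((1 - 2 * r * x * y + r ^ 2 : ℝ) : ℂ) ^ (lam + 1) *
        ordinaryHypergeometric ((lam + 1) / 2) ((lam + 2) / 2) (lam + 1 / 2)
          ((4 * r ^ 2 * (1 - x ^ 2) * (1 - y ^ 2) /
            (1 - 2 * r * x * y + r ^ 2) ^ 2 : ℝ) : ℂ)) := by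
  have hD := one_sub_two_mul_add_sq_pos hr hx hy
  have hZ := quotient_mem_Ico hr hx hy
  have hrn : ‖(r : ℂ)‖ < 1 := by
    rw [Complex.norm_real]
    exact abs_lt.2 hr
  have hlam0 : lam ≠ 0 := fun h => hlam 0 (by simp [h])
  have hsum := summable_norm_bilinearCoeff hlam hx hy
  have heq := tsum_bilinearCoeff_eq_gegenbauerKernel hlam hx hy
  have hDc : 1 - 2 * ((x : ℂ) * y) * r + (r : ℂ) ^ 2 = ((1 - 2 * r * x * y + r ^ 2 : ℝ) : ℂ) := by
    push_cast
    ring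
  have hZc : 4 * (r : ℂ) ^ 2 * ((1 - (x : ℂ) ^ 2) * (1 - (y : ℂ) ^ 2)) /
      ((1 - 2 * r * x * y + r ^ 2 : ℝ) : ℂ) ^ 2 =
      ((4 * r ^ 2 * (1 - x ^ 2) * (1 - y ^ 2) / (1 - 2 * r * x * y + r ^ 2) ^ 2 : ℝ) : ℂ) := by
    push_cast
    ring
  have h1 := hasSum_tsum_mul_pow hsum hrn
  have h2 := hasSum_deriv_tsum_mul_pow hsum hrn
  have hGr : ∑' n, bilinearCoeff lam x y n * (r : ℂ) ^ n = gegenbauerKernel lam x y r := heq hr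
  refine ⟨hD, hZ, ?_, ?_⟩
  · rw [hGr, gegenbauerKernel, hDc, hZc] at h1
    convert! h1 using 2 with n
    rw [bilinearCoeff]
    ring
  · obtain ⟨d, hd, hdeq⟩ := hasDerivAt_gegenbauerKernel hlam
      (kernel_denominator_mem_slitPlane hr hx hy) (norm_kernel_argument_lt_one hr hx hy)
    have hGd := (((differentiableOn_tsum_mul_pow hsum).differentiableAt
      (Metric.isOpen_ball.mem_nhds (mem_ball_zero_iff.2 hrn))).hasDerivAt).comp_ofReal
    -- The two sides are only known to agree for real `r`, so the derivatives are compared there.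
    have hderiv := (hGd.congr_of_eventuallyEq
      (heq.symm.eventuallyEq_of_mem (isOpen_Ioo.mem_nhds hr))).unique hd.comp_ofReal
    rw [hderiv] at h2
    rw [hGr] at h1
    have h3 := (h1.add (h2.mul_left lam⁻¹))
    have hval : gegenbauerKernel lam x y r + lam⁻¹ * (r * d) =
        ((1 - r ^ 2 : ℝ) : ℂ) / ((1 - 2 * r * x * y + r ^ 2 : ℝ) : ℂ) ^ (lam + 1) *
        ordinaryHypergeometric ((lam + 1) / 2) ((lam + 2) / 2) (lam + 1 / 2)
          ((4 * r ^ 2 * (1 - x ^ 2) * (1 - y ^ 2) /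
            (1 - 2 * r * x * y + r ^ 2) ^ 2 : ℝ) : ℂ) := by
      rw [hDc, hZc] at hdeq
      apply mul_left_cancel₀ hlam0
      rw [mul_add, mul_inv_cancel_left₀ hlam0, hdeq]
      push_cast
      rfl
    rw [hval] at h3
    convert! h3 using 2 with n
    rw [bilinearCoeff, add_div, div_self hlam0]
    ring
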